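/- Let $N\ge 1$, let $J\in C_0^\infty(\mathbb R^N)$ be radially symmetric with $J\ge 0$ and $\int J=1$, and put $Lv(x)=\int_{\mathbb R^N} J(x-y)\,(v(y)-v(x))\,dy$. Let $p>1$, $\alpha>0$, $A>0$, and let $u_0\in L^\infty(\mathbb R^N)$, $u_0\ge 0$, satisfy $|x|^\alpha u_0(x)\to A$ as $|x|\to\infty$. Let $u$ be the solution of $$u_t=Lu-|u|^{p-1}u\quad\text{in }\mathbb R^N\times(0,\infty),\qquad u(\cdot,0)=u_0,$$ that is, $u(\cdot,t)\in L^\infty(\mathbb R^N)$ for every $t\ge 0$, with a bound uniform on bounded time intervals, and for almost every $x$ the function $t\mapsto u(x,t)$ is continuous on $[0,\infty)$, equals $u_0(x)$ at $t=0$, is differentiable on $(0,\infty)$ and satisfies the equation there (where $u\ge0$ the absorption term is $u^p$). Statements about values or limits in $x$ are understood up to a Lebesgue-null set of $x$ not depending on $t$. Then: 1. For every $T<\infty$ there is a constant $C_T$ such that $u(x,t)\le C_T(1+|x|)^{-\alpha}$ for $0\le t\le T$. 2. If $\alpha<N$, there is a constant $C$ such that $u(x,t)\le C\,t^{-\alpha/2}$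 for all $x$ and all $t>0$. If $\alpha=N$, then for every $t_0>1$ there is a constant $C$ such that $u(x,t)\le C\,t^{-N/2}\log t$ for all $x$ and all $t\ge t_0$. 3. For every $T<\infty$, $|x|^\alpha u(x,t)\to A$ as $|x|\to\infty$, uniformly for $t\in[0,T]$. -/

import Mathlib

open MeasureTheory Filter Topology Set
open scoped ContDiff ENNReal

namespace NonlocalDiffusion

/-- The dispersal kernels: `J ∈ C_0^∞(ℝ^N)`, radially symmetric, `J ≥ 0`, `∫ J = 1`. -/
structure IsKernel {N : ℕ} (J : EuclideanSpace ℝ (Fin N) → ℝ) : Prop where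
  smooth : ContDiff ℝ ∞ J
  compactSupport : HasCompactSupport J
  radial : ∀ x y, ‖x‖ = ‖y‖ → J x = J y
  nonneg : ∀ x, 0 ≤ J x
  integral_eq_one : ∫ x, J x = 1

/-- The nonlocal diffusion operator `(Lv)(x) = ∫ J(x - y) (v(y) - v(x)) dy`. -/
noncomputable def nonlocalOp {N : ℕ} (J v : EuclideanSpace ℝ (Fin N) → ℝ)
    (x : EuclideanSpace ℝ (Fin N)) : ℝ :=
  ∫ y, J (x - y) * (v y - v x)

/-- The filter of the essential limit `|x| → ∞`: a property holds eventually along it iff it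
holds for almost every `x` outside some ball. -/
noncomputable def essInfty (N : ℕ) : Filter (EuclideanSpace ℝ (Fin N)) :=
  Bornology.cobounded (EuclideanSpace ℝ (Fin N)) ⊓ ae volume

/-- `u` (written `u t x`) is a solution on `ℝ^N × [0, ∞)` of `u_t = Lu - |u|^{p-1} u` with
`u(·, 0) = u₀`, bounded on bounded time intervals. The absorption term equals `u^p` where `u ≥ 0`;
no sign of `u` is presupposed. The functions `u(·, t)` are elements of `L^∞(ℝ^N)`, so everything
is required for almost every `x`; in time the equation holds in the classical sense. -/
structure IsSolution {N : ℕ} (J : EuclideanSpace ℝ (Fin N) → ℝ) (p : ℝ)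
    (u₀ : EuclideanSpace ℝ (Fin N) → ℝ) (u : ℝ → EuclideanSpace ℝ (Fin N) → ℝ) : Prop where
  measurable : ∀ t, 0 ≤ t → AEStronglyMeasurable (u t) volume
  locallyBounded : ∀ T : ℝ, ∃ M : ℝ, ∀ t ∈ Icc 0 T, ∀ᵐ x, |u t x| ≤ M
  initial : ∀ᵐ x, u 0 x = u₀ x
  continuous_zero : ∀ᵐ x, Tendsto (fun t => u t x) (𝓝[>] 0) (𝓝 (u 0 x))
  equation : ∀ᵐ x, ∀ t, 0 < t →
    HasDerivAt (fun s => u s x) (nonlocalOp J (u t) x - |u t x| ^ (p - 1) * u t x) t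

end NonlocalDiffusion

namespace NonlocalDiffusion

/-! Since `∫ J = 1`, `Lv = J * v - v`. Absorption lowers `u` wherever `u > 0`, so upper bounds
follow by comparing `u` with nonnegative supersolutions of the linear equation `w_t = J * w - w`
(`le_supersolution`). The comparison rests on a maximum principle for bounded functions, which needs
no attained maximum (`nonpos_of_subsolution`).

Finite time. `J` has bounded support, so `J * W ≤ κ W` for `W = (1 + |x|)^{-γ}`, and an exponential
in time times `W` is a supersolution; `γ = α` gives part 1. For part 3, `u - A (1 + |x|)^{-α}`
solves the linear equation with forcing `A L(1 + |x|)^{-α} - u^p`. Both terms decay faster than `(1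
+ |x|)^{-α}`: the first by the mean value theorem, the second by part 1 and `p > 1`. The initial
deviation is a small multiple of the weight plus a faster decaying term, and the comparison
preserves this form.

Large time. On slowly varying functions `L` is close to `(m / 2N) Δ`, with `m` the second moment of
`J` (`exists_kernelAvg_radial_le`). This suggests supersolutions `t^{-β} φ(r)` with `β = α/2`, `r =
|x|² / (κ t)`, `κ = 2m/N`. With `ν = N/2`, the limiting requirement is `(ν + r) φ' + r φ'' + β φ ≤
0`. The algebraic part `(1 + r)^{-β} + C (1 + r)^{-β-1}` meets it with margin `(1 + r)^{-β-1}`, up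
to an error of size `e^{-r}`; the margin pays for the Taylor remainder (`exists_profile_constants`).
A term `g(t) e^{-r}` contributes the gain `(t g' + (ν - β) g) e^{-r}`, which must stay above a
positive constant times `e^{-r}`. If `α < N`, `g = 1` works; if `α = N`, the Gaussian is neutral and
`g = log t` is needed, whence the logarithm. -/

/-- The average `∫ J(x - y) v(y) dy`. -/
noncomputable def kernelAvg {N : ℕ} (J v : EuclideanSpace ℝ (Fin N) → ℝ)
    (x : EuclideanSpace ℝ (Fin N)) : ℝ :=
  ∫ y, J (x - y) * v y

/-! ### Maximum principle. -/

/-- After the last time at which `z ≤ c`, `z` stays above `c`, hence is nonincreasing, and cannot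
have left the level `c`. -/
theorem le_of_deriv_nonpos_above {z : ℝ → ℝ} {T c : ℝ} (hcont : ContinuousOn z (Icc 0 T))
    (h0 : z 0 ≤ c) (hd : ∀ t ∈ Ioo 0 T, c < z t → ∃ d ≤ 0, HasDerivAt z d t) :
    ∀ t ∈ Icc 0 T, z t ≤ c := by
  intro t₁ ht₁
  by_contra! hlt
  have hcont₁ : ContinuousOn z (Icc 0 t₁) := hcont.mono (Icc_subset_Icc_right ht₁.2)
  set S := Icc 0 t₁ ∩ z ⁻¹' Iic c with hS
  have hScl : IsClosed S := hcont₁.preimage_isClosed_of_isClosed isClosed_Icc isClosed_Iic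
  have hSc : IsCompact S := isCompact_Icc.of_isClosed_subset hScl inter_subset_left
  obtain ⟨t₀, ht₀, hmax⟩ := hSc.exists_isGreatest ⟨0, ⟨le_rfl, ht₁.1⟩, h0⟩
  have hz₀ : z t₀ ≤ c := ht₀.2
  have ht₀₁ : t₀ < t₁ := lt_of_le_of_ne ht₀.1.2 (by rintro rfl; linarith)
  have habove : ∀ t ∈ Ioo t₀ t₁, ∃ d ≤ 0, HasDerivAt z d t := by
    intro t ht
    refine hd t ⟨ht₀.1.1.trans_lt ht.1, ht.2.trans_le ht₁.2⟩ ?_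
    by_contra! hle
    have := hmax (show t ∈ S from ⟨⟨ht₀.1.1.trans ht.1.le, ht.2.le⟩, hle⟩)
    linarith [ht.1]
  have hanti : AntitoneOn z (Icc t₀ t₁) := by
    apply antitoneOn_of_deriv_nonpos (convex_Icc _ _)
    · exact hcont₁.mono (Icc_subset_Icc_left ht₀.1.1)
    · rw [interior_Icc]
      intro t ht
      obtain ⟨d, -, h⟩ := habove t ht
      exact h.differentiableAt.differentiableWithinAt
    · rw [interior_Icc]
      intro t ht
      obtain ⟨d, hd', h⟩ := habove t ht
      rwa [h.deriv]
  have := hanti (left_mem_Icc.2 ht₀₁.le) (right_mem_Icc.2 ht₀₁.le) ht₀₁.le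
  linarith

variable {N : ℕ} {J : EuclideanSpace ℝ (Fin N) → ℝ}

theorem IsKernel.integrable (hJ : IsKernel J) : Integrable J :=
  hJ.smooth.continuous.integrable_of_hasCompactSupport hJ.compactSupport

theorem IsKernel.integrable_shift (hJ : IsKernel J) (x : EuclideanSpace ℝ (Fin N)) :
    Integrable (fun y => J (x - y)) :=
  hJ.integrable.comp_sub_left x

theorem IsKernel.integral_shift (hJ : IsKernel J) (x : EuclideanSpace ℝ (Fin N)) :
    ∫ y, J (x - y) = 1 := by
  rw [integral_sub_left_eq_self J volume x, hJ.integral_eq_one]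

theorem IsKernel.integrable_shift_mul (hJ : IsKernel J) (x : EuclideanSpace ℝ (Fin N))
    {v : EuclideanSpace ℝ (Fin N) → ℝ} (hv : AEStronglyMeasurable v volume) {M : ℝ}
    (hM : ∀ᵐ y, |v y| ≤ M) : Integrable (fun y => J (x - y) * v y) :=
  (hJ.integrable_shift x).mul_bdd hv hM

theorem IsKernel.nonlocalOp_eq (hJ : IsKernel J) (x : EuclideanSpace ℝ (Fin N))
    {v : EuclideanSpace ℝ (Fin N) → ℝ} (hv : AEStronglyMeasurable v volume) {M : ℝ}
    (hM : ∀ᵐ y, |v y| ≤ M) : nonlocalOp J v x = kernelAvg J v x - v x := by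
  simp only [nonlocalOp, kernelAvg, mul_sub]
  rw [integral_sub (hJ.integrable_shift_mul x hv hM) ((hJ.integrable_shift x).mul_const _),
    integral_mul_const, hJ.integral_shift, one_mul]

theorem IsKernel.kernelAvg_le (hJ : IsKernel J) (x : EuclideanSpace ℝ (Fin N))
    {v : EuclideanSpace ℝ (Fin N) → ℝ} {M : ℝ} (hM0 : 0 ≤ M) (hM : ∀ᵐ y, v y ≤ M) :
    kernelAvg J v x ≤ M := by
  by_cases hi : Integrable (fun y => J (x - y) * v y)
  · calc kernelAvg J v x ≤ ∫ y, J (x - y) * M := by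
          apply integral_mono_ae hi ((hJ.integrable_shift x).mul_const _)
          filter_upwards [hM] with y hy
          exact mul_le_mul_of_nonneg_left hy (hJ.nonneg _)
      _ = M := by rw [integral_mul_const, hJ.integral_shift, one_mul]
  -- A non-integrable integrand has integral `0` by convention; this is where `0 ≤ M` enters.
  · rw [kernelAvg, integral_undef hi]
    exact hM0

/-- Maximum principle for bounded subsolutions of `z_t = J * z`. -/
theorem IsKernel.nonpos_of_subsolution (hJ : IsKernel J)
    {z : ℝ → EuclideanSpace ℝ (Fin N) → ℝ} {T M : ℝ}
    (hcont : ∀ᵐ x, ContinuousOn (fun t => z t x) (Icc 0 T))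
    (hbdd : ∀ᵐ x, ∀ t ∈ Icc 0 T, z t x ≤ M)
    (h0 : ∀ᵐ x, z 0 x ≤ 0)
    (hd : ∀ᵐ x, ∀ t ∈ Ioo 0 T, 0 < z t x →
      ∃ d ≤ kernelAvg J (z t) x, HasDerivAt (fun s => z s x) d t) :
    ∀ᵐ x, ∀ t ∈ Icc 0 T, z t x ≤ 0 := by
  -- For `y = e^{-2t} z`, a bound `y ≤ c` gives `y' ≤ c - 2y` where `y > 0`, so `y` cannot rise
  -- above `c/2`. Each pass halves the bound.
  have key : ∀ n : ℕ, ∀ᵐ x, ∀ t ∈ Icc 0 T, Real.exp (-(2 * t)) * z t x ≤ |M| / 2 ^ n := by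
    intro n
    induction n with
    | zero =>
      filter_upwards [hbdd] with x hx t ht
      have h1 : Real.exp (-(2 * t)) ≤ 1 := Real.exp_le_one_iff.2 (by linarith [ht.1])
      calc Real.exp (-(2 * t)) * z t x ≤ Real.exp (-(2 * t)) * |M| :=
            mul_le_mul_of_nonneg_left ((hx t ht).trans (le_abs_self M)) (Real.exp_nonneg _)
        _ ≤ |M| / 2 ^ 0 := by
            have := mul_le_mul_of_nonneg_right h1 (abs_nonneg M)
            simpa using this
    | succ n ih =>
      have hc0 : 0 ≤ |M| / 2 ^ n := by positivity
      have hc1 : |M| / 2 ^ (n + 1) = |M| / 2 ^ n / 2 := by rw [pow_succ]; field_simp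
      rw [hc1]
      set c := |M| / 2 ^ n
      filter_upwards [hcont, h0, hd] with x hcx h0x hdx
      apply le_of_deriv_nonpos_above
      · exact (Continuous.continuousOn (by fun_prop)).mul hcx
      · simp only [mul_zero, neg_zero, Real.exp_zero, one_mul]
        linarith
      · intro t ht hpos
        have hz : 0 < z t x := by
          by_contra! hle
          have := mul_nonpos_of_nonneg_of_nonpos (Real.exp_nonneg (-(2 * t))) hle
          linarith
        obtain ⟨d, hd', hder⟩ := hdx t ht hz
        have hexp : HasDerivAt (fun s : ℝ => Real.exp (-(2 * s)))
            (Real.exp (-(2 * t)) * -(2 * 1)) t :=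
          (((hasDerivAt_id t).const_mul 2).neg).exp
        refine ⟨_, ?_, hexp.mul hder⟩
        have havg : kernelAvg J (z t) x ≤ Real.exp (2 * t) * c := by
          apply hJ.kernelAvg_le x (by positivity)
          filter_upwards [ih] with y hy
          have := hy t (Ioo_subset_Icc_self ht)
          calc z t y = Real.exp (2 * t) * (Real.exp (-(2 * t)) * z t y) := by
                rw [← mul_assoc, ← Real.exp_add]; simp
            _ ≤ _ := mul_le_mul_of_nonneg_left this (Real.exp_nonneg _)
        have h3 : Real.exp (-(2 * t)) * d ≤ c := by
          calc Real.exp (-(2 * t)) * d ≤ Real.exp (-(2 * t)) * (Real.exp (2 * t) * c) :=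
                mul_le_mul_of_nonneg_left (hd'.trans havg) (Real.exp_nonneg _)
            _ = c := by rw [← mul_assoc, ← Real.exp_add]; simp
        nlinarith
  filter_upwards [ae_all_iff.2 key] with x hx t ht
  have hlim : Tendsto (fun n : ℕ => |M| / 2 ^ n) atTop (𝓝 0) := by
    have := (tendsto_pow_atTop_nhds_zero_of_lt_one (r := (1 / 2 : ℝ)) (by norm_num)
      (by norm_num)).const_mul |M|
    simpa [div_eq_mul_inv] using this
  have := ge_of_tendsto' hlim (fun n => hx n t ht)
  exact nonpos_of_mul_nonpos_right this (Real.exp_pos _)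

/-! ### Basic properties of solutions. -/

section Solution

variable {p : ℝ} {u₀ : EuclideanSpace ℝ (Fin N) → ℝ} {u : ℝ → EuclideanSpace ℝ (Fin N) → ℝ}

theorem IsSolution.continuousOn (hu : IsSolution J p u₀ u) :
    ∀ᵐ x, ContinuousOn (fun t => u t x) (Ici 0) := by
  filter_upwards [hu.continuous_zero, hu.equation] with x h0 hx t ht
  rcases eq_or_lt_of_le (mem_Ici.1 ht) with rfl | ht
  · exact continuousWithinAt_Ioi_iff_Ici.1 h0
  · exact (hx t ht).continuousAt.continuousWithinAt

/-- Exchanges "for all `t`, almost every `x`" for a single null set: a countable union handles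
rational times, and continuity in `t` the others. -/
theorem IsSolution.ae_bounded (hu : IsSolution J p u₀ u) (T : ℝ) :
    ∃ M : ℝ, ∀ᵐ x, ∀ t ∈ Icc 0 T, |u t x| ≤ M := by
  -- The extra unit of time leaves room for rational times slightly beyond `T`.
  obtain ⟨M, hM⟩ := hu.locallyBounded (T + 1)
  refine ⟨M, ?_⟩
  have hq : ∀ᵐ x, ∀ q : ℚ, (q : ℝ) ∈ Icc 0 (T + 1) → |u q x| ≤ M := by
    rw [ae_all_iff]
    intro q
    by_cases h : (q : ℝ) ∈ Icc 0 (T + 1)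
    · filter_upwards [hM q h] with x hx _ using hx
    · exact Eventually.of_forall fun x h' => absurd h' h
  filter_upwards [hq, hu.equation] with x hqx hx t ht
  rcases eq_or_lt_of_le ht.1 with rfl | htpos
  · simpa using hqx 0 (by simpa using by linarith [ht.2])
  by_contra! hlt
  have hev : ∀ᶠ s in 𝓝 t, M < |u s x| ∧ s ∈ Ioo 0 (T + 1) :=
    ((hx t htpos).continuousAt.abs.eventually_const_lt hlt).and
      (Ioo_mem_nhds htpos (by linarith [ht.2]))
  obtain ⟨l, r, ⟨hl, hr⟩, hsub⟩ := mem_nhds_iff_exists_Ioo_subset.1 hev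
  obtain ⟨q, hq1, hq2⟩ := exists_rat_btwn (hl.trans hr)
  obtain ⟨h1, h2⟩ := hsub ⟨hq1, hq2⟩
  exact absurd (hqx q (Ioo_subset_Icc_self h2)) (not_le.2 h1)

theorem IsSolution.hasDerivAt (hJ : IsKernel J) (hu : IsSolution J p u₀ u) :
    ∀ᵐ x, ∀ t, 0 < t → HasDerivAt (fun s => u s x)
      (kernelAvg J (u t) x - u t x - |u t x| ^ (p - 1) * u t x) t := by
  filter_upwards [hu.equation] with x hx t ht
  obtain ⟨M, hM⟩ := hu.locallyBounded t
  rw [← hJ.nonlocalOp_eq x (hu.measurable t ht.le) (hM t ⟨ht.le, le_rfl⟩)]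
  exact hx t ht

theorem ae_forall_nonneg_of_nat {P : ℝ → EuclideanSpace ℝ (Fin N) → Prop}
    (h : ∀ n : ℕ, ∀ᵐ x, ∀ t ∈ Icc (0 : ℝ) n, P t x) : ∀ᵐ x, ∀ t, 0 ≤ t → P t x := by
  filter_upwards [ae_all_iff.2 h] with x hx t ht
  obtain ⟨n, hn⟩ := exists_nat_ge t
  exact hx n t ⟨ht, hn⟩

theorem IsSolution.nonneg (hJ : IsKernel J) (hu : IsSolution J p u₀ u)
    (hu₀ : ∀ᵐ x, 0 ≤ u₀ x) : ∀ᵐ x, ∀ t, 0 ≤ t → 0 ≤ u t x := by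
  apply ae_forall_nonneg_of_nat
  intro n
  obtain ⟨M, hM⟩ := hu.ae_bounded n
  -- Where `-u > 0`, the zeroth order and absorption terms both push `-u` down, leaving a
  -- subsolution of `z_t = J * z`.
  have : ∀ᵐ x, ∀ t ∈ Icc (0 : ℝ) n, -u t x ≤ 0 := by
    apply hJ.nonpos_of_subsolution (M := M)
    · filter_upwards [hu.continuousOn] with x hx
      exact (hx.mono Icc_subset_Ici_self).neg
    · filter_upwards [hM] with x hx t ht
      exact (neg_le_abs _).trans (hx t ht)
    · filter_upwards [hu.initial, hu₀] with x h1 h2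
      rw [h1]; linarith
    · filter_upwards [hu.hasDerivAt hJ] with x hx t ht hpos
      refine ⟨_, ?_, (hx t ht.1).neg⟩
      have h1 : kernelAvg J (fun y => -u t y) x = -kernelAvg J (u t) x := by
        simp [kernelAvg, integral_neg]
      have h2 : 0 ≤ |u t x| ^ (p - 1) := by positivity
      rw [h1]
      nlinarith
  filter_upwards [this] with x hx t ht
  linarith [hx t ht]

end Solution

/-! ### Comparison with supersolutions. -/

theorem IsKernel.exists_radius (hJ : IsKernel J) :
    ∃ R : ℝ, 1 ≤ R ∧ ∀ z, J z ≠ 0 → ‖z‖ ≤ R := by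
  obtain ⟨R, hR⟩ := hJ.compactSupport.isCompact.isBounded.exists_norm_le
  exact ⟨max R 1, le_max_right _ _,
    fun z hz => (hR z (subset_tsupport J hz)).trans (le_max_left _ _)⟩

theorem IsKernel.kernelAvg_le_of_support (hJ : IsKernel J) (x : EuclideanSpace ℝ (Fin N))
    {v : EuclideanSpace ℝ (Fin N) → ℝ} (hv : AEStronglyMeasurable v volume) {M c : ℝ}
    (hM : ∀ᵐ y, |v y| ≤ M) (hc : ∀ y, J (x - y) ≠ 0 → v y ≤ c) :
    kernelAvg J v x ≤ c := by
  calc kernelAvg J v x ≤ ∫ y, J (x - y) * c := by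
        apply integral_mono (hJ.integrable_shift_mul x hv hM)
          ((hJ.integrable_shift x).mul_const _)
        intro y
        by_cases h : J (x - y) = 0
        · simp [h]
        · exact mul_le_mul_of_nonneg_left (hc y h) (hJ.nonneg _)
    _ = c := by rw [integral_mul_const, hJ.integral_shift, one_mul]

theorem kernelAvg_const_mul (c : ℝ) (v : EuclideanSpace ℝ (Fin N) → ℝ)
    (x : EuclideanSpace ℝ (Fin N)) :
    kernelAvg J (fun y => c * v y) x = c * kernelAvg J v x := by
  simp only [kernelAvg, mul_left_comm _ c]
  exact integral_const_mul _ _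

theorem IsKernel.kernelAvg_add (hJ : IsKernel J) (x : EuclideanSpace ℝ (Fin N))
    {v w : EuclideanSpace ℝ (Fin N) → ℝ} (hv : AEStronglyMeasurable v volume)
    (hw : AEStronglyMeasurable w volume) {M M' : ℝ} (hM : ∀ᵐ y, |v y| ≤ M)
    (hM' : ∀ᵐ y, |w y| ≤ M') :
    kernelAvg J (fun y => v y + w y) x = kernelAvg J v x + kernelAvg J w x := by
  simp only [kernelAvg, mul_add]
  exact integral_add (hJ.integrable_shift_mul x hv hM) (hJ.integrable_shift_mul x hw hM')

theorem IsKernel.kernelAvg_sub (hJ : IsKernel J) (x : EuclideanSpace ℝ (Fin N))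
    {v w : EuclideanSpace ℝ (Fin N) → ℝ} (hv : AEStronglyMeasurable v volume)
    (hw : AEStronglyMeasurable w volume) {M M' : ℝ} (hM : ∀ᵐ y, |v y| ≤ M)
    (hM' : ∀ᵐ y, |w y| ≤ M') :
    kernelAvg J (fun y => v y - w y) x = kernelAvg J v x - kernelAvg J w x := by
  simp only [kernelAvg, mul_sub]
  exact integral_sub (hJ.integrable_shift_mul x hv hM) (hJ.integrable_shift_mul x hw hM')

/-- Comparison of a subsolution of `z_t = J * z - z + G` with a nonnegative supersolution. -/
theorem IsKernel.le_supersolution (hJ : IsKernel J)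
    {z W G : ℝ → EuclideanSpace ℝ (Fin N) → ℝ} {T M M' : ℝ}
    (hzm : ∀ t ∈ Ioo 0 T, AEStronglyMeasurable (z t) volume)
    (hzc : ∀ᵐ x, ContinuousOn (fun t => z t x) (Icc 0 T))
    (hzb : ∀ᵐ x, ∀ t ∈ Icc 0 T, |z t x| ≤ M)
    (hzd : ∀ᵐ x, ∀ t ∈ Ioo 0 T, 0 < z t x →
      ∃ d ≤ kernelAvg J (z t) x - z t x + G t x, HasDerivAt (fun s => z s x) d t)
    (hWm : ∀ t ∈ Ioo 0 T, AEStronglyMeasurable (W t) volume)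
    (hW0 : ∀ t ∈ Icc 0 T, ∀ x, 0 ≤ W t x)
    (hWb : ∀ t ∈ Icc 0 T, ∀ x, W t x ≤ M')
    (hWc : ∀ x, ContinuousOn (fun t => W t x) (Icc 0 T))
    (hWd : ∀ x, ∀ t ∈ Ioo 0 T,
      ∃ d ≥ kernelAvg J (W t) x - W t x + G t x, HasDerivAt (fun s => W s x) d t)
    (h0 : ∀ᵐ x, z 0 x ≤ W 0 x) :
    ∀ᵐ x, ∀ t ∈ Icc 0 T, z t x ≤ W t x := by
  have : ∀ᵐ x, ∀ t ∈ Icc 0 T, z t x - W t x ≤ 0 := by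
    apply hJ.nonpos_of_subsolution (M := M)
    · filter_upwards [hzc] with x hx
      exact hx.sub (hWc x)
    · filter_upwards [hzb] with x hx t ht
      linarith [hW0 t ht x, le_abs_self (z t x), hx t ht]
    · filter_upwards [h0] with x hx
      linarith
    · filter_upwards [hzd] with x hx t ht hpos
      have ht' := Ioo_subset_Icc_self ht
      -- As `W ≥ 0`, positivity of `z - W` forces `z > 0`, where the differential inequality for `z`
      -- is available.
      obtain ⟨d, hd, hder⟩ := hx t ht (by linarith [hW0 t ht' x])
      obtain ⟨e, he, hder'⟩ := hWd x t ht
      refine ⟨d - e, ?_, hder.sub hder'⟩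
      have h1 : ∀ᵐ y, |z t y| ≤ M := by
        filter_upwards [hzb] with y hy using hy t ht'
      have h2 : ∀ᵐ y, |W t y| ≤ M' :=
        Eventually.of_forall fun y => by rw [abs_of_nonneg (hW0 t ht' y)]; exact hWb t ht' y
      rw [hJ.kernelAvg_sub x (hzm t ht) (hWm t ht) h1 h2]
      linarith
  filter_upwards [this] with x hx t ht
  linarith [hx t ht]

/-- Exponential-in-time control by a spatial weight `W` with `J * W ≤ κ W`. -/
theorem IsKernel.le_exp_mul_weight (hJ : IsKernel J)
    {z : ℝ → EuclideanSpace ℝ (Fin N) → ℝ} {W : EuclideanSpace ℝ (Fin N) → ℝ} {T M M' κ : ℝ}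
    (hκ : 0 ≤ κ)
    (hzm : ∀ t ∈ Ioo 0 T, AEStronglyMeasurable (z t) volume)
    (hzc : ∀ᵐ x, ContinuousOn (fun t => z t x) (Icc 0 T))
    (hzb : ∀ᵐ x, ∀ t ∈ Icc 0 T, |z t x| ≤ M)
    (hzd : ∀ᵐ x, ∀ t ∈ Ioo 0 T, 0 < z t x →
      ∃ d ≤ kernelAvg J (z t) x - z t x + W x, HasDerivAt (fun s => z s x) d t)
    (hWm : AEStronglyMeasurable W volume)
    (hW0 : ∀ x, 0 ≤ W x) (hWb : ∀ x, W x ≤ M')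
    (hWκ : ∀ x, kernelAvg J W x ≤ κ * W x)
    (h0 : ∀ᵐ x, z 0 x ≤ W x) :
    ∀ᵐ x, ∀ t ∈ Icc 0 T, z t x ≤ Real.exp ((κ + 1) * T) * W x := by
  -- The rate `κ` pays for `J * W`; the additional `1` pays for the forcing `W`.
  have key : ∀ᵐ x, ∀ t ∈ Icc 0 T, z t x ≤ Real.exp ((κ + 1) * t) * W x := by
    have hmono : ∀ t ∈ Icc 0 T, Real.exp ((κ + 1) * t) ≤ Real.exp ((κ + 1) * T) :=
      fun t ht => Real.exp_le_exp.2 (mul_le_mul_of_nonneg_left ht.2 (by linarith))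
    apply hJ.le_supersolution (W := fun t x => Real.exp ((κ + 1) * t) * W x)
      (G := fun _ => W) (M' := Real.exp ((κ + 1) * T) * M') hzm hzc hzb hzd
    · exact fun t _ => hWm.const_mul _
    · exact fun t _ x => mul_nonneg (Real.exp_nonneg _) (hW0 x)
    · exact fun t ht x => mul_le_mul (hmono t ht) (hWb x) (hW0 x) (Real.exp_nonneg _)
    · exact fun x => Continuous.continuousOn (by fun_prop)
    · intro x t ht
      have hexp : HasDerivAt (fun s : ℝ => Real.exp ((κ + 1) * s))
          (Real.exp ((κ + 1) * t) * ((κ + 1) * 1)) t :=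
        ((hasDerivAt_id t).const_mul (κ + 1)).exp
      refine ⟨_, ?_, hexp.mul_const (W x)⟩
      rw [kernelAvg_const_mul]
      have h1 : 1 ≤ Real.exp ((κ + 1) * t) :=
        Real.one_le_exp (mul_nonneg (by linarith) ht.1.le)
      have h2 := mul_le_mul_of_nonneg_left (hWκ x) (Real.exp_nonneg ((κ + 1) * t))
      have h3 := mul_nonneg (Real.exp_nonneg ((κ + 1) * t)) (hW0 x)
      nlinarith [hW0 x]
    · simpa using h0
  filter_upwards [key] with x hx t ht
  refine (hx t ht).trans (mul_le_mul_of_nonneg_right ?_ (hW0 x))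
  exact Real.exp_le_exp.2 (mul_le_mul_of_nonneg_left ht.2 (by linarith))

/-! ### Algebraic weights. -/

/-- The weight `(1 + |x|)^{-γ}`. -/
noncomputable def decay (N : ℕ) (γ : ℝ) (x : EuclideanSpace ℝ (Fin N)) : ℝ := (1 + ‖x‖) ^ (-γ)

theorem decay_pos (γ : ℝ) (x : EuclideanSpace ℝ (Fin N)) : 0 < decay N γ x := by
  unfold decay; positivity

theorem decay_anti {γ γ' : ℝ} (h : γ ≤ γ') (x : EuclideanSpace ℝ (Fin N)) :
    decay N γ' x ≤ decay N γ x :=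
  Real.rpow_le_rpow_of_exponent_le (by linarith [norm_nonneg x]) (by linarith)

theorem decay_le_one {γ : ℝ} (h : 0 ≤ γ) (x : EuclideanSpace ℝ (Fin N)) : decay N γ x ≤ 1 := by
  have := decay_anti h x
  simpa [decay] using this

theorem decay_add (γ δ : ℝ) (x : EuclideanSpace ℝ (Fin N)) :
    decay N (γ + δ) x = decay N γ x * decay N δ x := by
  rw [decay, neg_add, Real.rpow_add (by positivity)]; rfl

theorem continuous_decay (γ : ℝ) : Continuous (decay N γ) := by
  unfold decay
  exact Continuous.rpow_const (by fun_prop) fun x => Or.inl (by positivity)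

theorem aestronglyMeasurable_decay (γ : ℝ) : AEStronglyMeasurable (decay N γ) volume :=
  (continuous_decay γ).aestronglyMeasurable

theorem ae_abs_decay_le_one {γ : ℝ} (h : 0 ≤ γ) : ∀ᵐ x, |decay N γ x| ≤ 1 :=
  Eventually.of_forall fun x => by rw [abs_of_pos (decay_pos γ x)]; exact decay_le_one h x

theorem tendsto_decay {γ : ℝ} (h : 0 < γ) :
    Tendsto (decay N γ) (Bornology.cobounded _) (𝓝 0) := by
  have h1 : Tendsto (fun x : EuclideanSpace ℝ (Fin N) => 1 + ‖x‖) (Bornology.cobounded _) atTop :=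
    tendsto_atTop_add_const_left _ _ tendsto_norm_cobounded_atTop
  exact (tendsto_rpow_neg_atTop h).comp h1

theorem tendsto_norm_rpow_mul_decay (α : ℝ) :
    Tendsto (fun x => ‖x‖ ^ α * decay N α x) (Bornology.cobounded _) (𝓝 1) := by
  have h0 : Tendsto (decay N 1) (Bornology.cobounded _) (𝓝 0) := tendsto_decay one_pos
  have h1 : Tendsto (fun x => (1 - decay N 1 x) ^ α) (Bornology.cobounded _) (𝓝 1) := by
    have := (tendsto_const_nhds (x := (1 : ℝ))).sub h0
    rw [sub_zero] at this
    simpa using this.rpow_const (p := α) (Or.inl one_ne_zero)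
  refine h1.congr fun x => ?_
  have hpos : (0 : ℝ) < 1 + ‖x‖ := by positivity
  have : 1 - decay N 1 x = ‖x‖ * (1 + ‖x‖)⁻¹ := by
    rw [decay, Real.rpow_neg_one]; field_simp; ring
  rw [this, Real.mul_rpow (norm_nonneg _) (by positivity), decay, Real.inv_rpow hpos.le,
    Real.rpow_neg hpos.le]

theorem decay_le_of_norm_sub_le {γ R : ℝ} (hγ : 0 ≤ γ) {x y : EuclideanSpace ℝ (Fin N)}
    (hxy : ‖x - y‖ ≤ R) : decay N γ y ≤ (1 + R) ^ γ * decay N γ x := by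
  have hR : 0 ≤ R := (norm_nonneg _).trans hxy
  have h1 : 1 + ‖x‖ ≤ (1 + R) * (1 + ‖y‖) := by
    have := norm_le_norm_add_norm_sub' x y
    nlinarith [norm_nonneg y]
  have h2 : (1 + ‖x‖) ^ γ ≤ (1 + R) ^ γ * (1 + ‖y‖) ^ γ := by
    rw [← Real.mul_rpow (by positivity) (by positivity)]
    exact Real.rpow_le_rpow (by positivity) h1 hγ
  have hx : 0 < (1 + ‖x‖) ^ γ := by positivity
  have hy : 0 < (1 + ‖y‖) ^ γ := by positivity
  rw [decay, decay, Real.rpow_neg (by positivity), Real.rpow_neg (by positivity),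
    ← div_eq_mul_inv, le_div_iff₀ hx, inv_mul_le_iff₀ hy]
  linarith

/-- Mean value inequality for `s ↦ s^{-γ}`: differentiation gains one power, and `(1 + |x|) / (1 +
R)` lies below both `1 + |x|` and `1 + |y|`. -/
theorem abs_decay_sub_le {γ R : ℝ} (hγ : 0 ≤ γ) {x y : EuclideanSpace ℝ (Fin N)}
    (hxy : ‖x - y‖ ≤ R) :
    |decay N γ y - decay N γ x| ≤ γ * (1 + R) ^ (γ + 1) * R * decay N (γ + 1) x := by
  have hR : 0 ≤ R := (norm_nonneg _).trans hxy
  set a := (1 + ‖x‖) / (1 + R) with ha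
  have ha0 : 0 < a := by positivity
  have hax : a ≤ 1 + ‖x‖ := by
    rw [ha, div_le_iff₀ (by positivity)]; nlinarith [norm_nonneg x]
  have hay : a ≤ 1 + ‖y‖ := by
    rw [ha, div_le_iff₀ (by positivity)]
    have := norm_le_norm_add_norm_sub' x y
    nlinarith [norm_nonneg y]
  have hderiv : ∀ s ∈ Ici a, HasDerivWithinAt (fun s : ℝ => s ^ (-γ))
      (-γ * s ^ (-γ - 1)) (Ici a) s := fun s hs =>
    (Real.hasDerivAt_rpow_const (Or.inl (ha0.trans_le hs).ne')).hasDerivWithinAt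
  have hbound : ∀ s ∈ Ici a, ‖-γ * s ^ (-γ - 1)‖ ≤ γ * a ^ (-γ - 1) := by
    intro s hs
    have hs0 : 0 < s := ha0.trans_le hs
    rw [norm_mul, norm_neg, Real.norm_of_nonneg hγ, Real.norm_of_nonneg (by positivity)]
    exact mul_le_mul_of_nonneg_left (Real.rpow_le_rpow_of_nonpos ha0 hs (by linarith)) hγ
  have hmv := (convex_Ici a).norm_image_sub_le_of_norm_hasDerivWithin_le hderiv hbound
    (mem_Ici.2 hax) (mem_Ici.2 hay)
  have hdist : ‖(1 + ‖y‖) - (1 + ‖x‖)‖ ≤ R := by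
    rw [Real.norm_eq_abs, add_sub_add_left_eq_sub]
    exact (abs_norm_sub_norm_le y x).trans (by rwa [norm_sub_rev])
  have hapow : a ^ (-γ - 1) = (1 + R) ^ (γ + 1) * decay N (γ + 1) x := by
    rw [ha, Real.div_rpow (by positivity) (by positivity), decay,
      show -γ - 1 = -(γ + 1) by ring, Real.rpow_neg (x := 1 + R) (by positivity), div_inv_eq_mul,
      mul_comm]
  calc |decay N γ y - decay N γ x| ≤ γ * a ^ (-γ - 1) * ‖(1 + ‖y‖) - (1 + ‖x‖)‖ := hmv
    _ ≤ γ * a ^ (-γ - 1) * R := mul_le_mul_of_nonneg_left hdist (by positivity)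
    _ = _ := by rw [hapow]; ring

theorem IsKernel.exists_kernelAvg_decay_le (hJ : IsKernel J) {γ : ℝ} (hγ : 0 ≤ γ) :
    ∃ κ : ℝ, 0 ≤ κ ∧ ∀ x, kernelAvg J (decay N γ) x ≤ κ * decay N γ x := by
  obtain ⟨R, hR1, hR⟩ := hJ.exists_radius
  refine ⟨(1 + R) ^ γ, by positivity, fun x => ?_⟩
  exact hJ.kernelAvg_le_of_support x (aestronglyMeasurable_decay γ) (ae_abs_decay_le_one hγ)
    fun y hy => decay_le_of_norm_sub_le hγ (hR _ hy)

/-- The weight solves the stationary linear equation up to a residual with one more power of decay.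
-/
theorem IsKernel.exists_abs_kernelAvg_decay_sub_le (hJ : IsKernel J) {γ : ℝ} (hγ : 0 ≤ γ) :
    ∃ K : ℝ, 0 ≤ K ∧ ∀ x, |kernelAvg J (decay N γ) x - decay N γ x| ≤ K * decay N (γ + 1) x := by
  obtain ⟨R, hR1, hR⟩ := hJ.exists_radius
  refine ⟨γ * (1 + R) ^ (γ + 1) * R, by positivity, fun x => ?_⟩
  have hm := aestronglyMeasurable_decay (N := N) γ
  have hb := ae_abs_decay_le_one (N := N) hγ
  have hclose : ∀ y, J (x - y) ≠ 0 → _ := fun y hy => abs_le.1 (abs_decay_sub_le hγ (hR _ hy))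
  have h1 := hJ.kernelAvg_le_of_support x hm hb
    (c := decay N γ x + γ * (1 + R) ^ (γ + 1) * R * decay N (γ + 1) x)
    fun y hy => by linarith [(hclose y hy).2]
  have h2 := hJ.kernelAvg_le_of_support x (v := fun y => -1 * decay N γ y) (hm.const_mul _)
    (M := 1) (by simpa using hb)
    (c := -decay N γ x + γ * (1 + R) ^ (γ + 1) * R * decay N (γ + 1) x)
    fun y hy => by linarith [(hclose y hy).1]
  rw [kernelAvg_const_mul] at h2
  exact abs_le.2 ⟨by linarith, by linarith⟩

theorem eventually_essInfty_iff {P : EuclideanSpace ℝ (Fin N) → Prop} :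
    (∀ᶠ x in essInfty N, P x) ↔ ∃ ρ : ℝ, ∀ᵐ x, ρ ≤ ‖x‖ → P x := by
  rw [essInfty, eventually_inf]
  constructor
  · rintro ⟨s, hs, t, ht, h⟩
    obtain ⟨ρ, -, hρ⟩ := hasBasis_cobounded_norm.mem_iff.1 hs
    refine ⟨ρ, ?_⟩
    filter_upwards [ht] with x hx hn
    exact h x ⟨hρ hn, hx⟩
  · rintro ⟨ρ, hρ⟩
    exact ⟨{x | ρ ≤ ‖x‖}, hasBasis_cobounded_norm.mem_of_mem trivial, _, hρ,
      fun x hx => hx.2 hx.1⟩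

/-- Splitting of the initial datum: its deviation from `A (1 + |x|)^{-α}` is a small multiple of
that weight up to a faster decaying one. -/
theorem exists_initial_bound {u₀ : EuclideanSpace ℝ (Fin N) → ℝ} {α A M : ℝ} (hα : 0 ≤ α)
    (hA : 0 ≤ A) (hM : ∀ᵐ x, |u₀ x| ≤ M)
    (hlim : Tendsto (fun x => ‖x‖ ^ α * u₀ x) (essInfty N) (𝓝 A)) {γ : ℝ} (hγ : 0 ≤ γ) {ε : ℝ}
    (hε : 0 < ε) :
    ∃ C : ℝ, 0 ≤ C ∧ ∀ᵐ x, |u₀ x - A * decay N α x| ≤ ε * decay N α x + C * decay N γ x := by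
  have h1 : Tendsto (fun x => (decay N α x)⁻¹ * u₀ x) (essInfty N) (𝓝 A) := by
    have := (hlim.div ((tendsto_norm_rpow_mul_decay α).mono_left inf_le_left) one_ne_zero)
    rw [div_one] at this
    refine this.congr' ?_
    have hne : ∀ᶠ x in essInfty N, 0 < ‖x‖ :=
      (tendsto_norm_cobounded_atTop.eventually_gt_atTop 0).filter_mono inf_le_left
    filter_upwards [hne] with x hx
    have := decay_pos α x
    have : 0 < ‖x‖ ^ α := by positivity
    simp only [Pi.div_apply]
    field_simp
  have h2 : ∀ᶠ x in essInfty N, |(decay N α x)⁻¹ * u₀ x - A| < ε := by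
    simpa [Real.dist_eq] using (Metric.tendsto_nhds.1 h1 ε hε)
  obtain ⟨ρ, hρ⟩ := eventually_essInfty_iff.1 h2
  -- Inside the ball of radius `ρ` the deviation is at most `|M| + A`, while `(1 + |ρ|) ^ γ * decay
  -- N γ x ≥ 1`.
  refine ⟨(|M| + A) * (1 + |ρ|) ^ γ, by positivity, ?_⟩
  filter_upwards [hρ, hM] with x hx hMx
  have hd := decay_pos α x
  have hdγ := decay_pos γ x
  rcases le_or_gt ρ ‖x‖ with h | h
  · have h3 : u₀ x - A * decay N α x = ((decay N α x)⁻¹ * u₀ x - A) * decay N α x := by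
      field_simp
    rw [h3, abs_mul, abs_of_pos hd]
    have := mul_le_mul_of_nonneg_right (hx h).le hd.le
    have : 0 ≤ (|M| + A) * (1 + |ρ|) ^ γ * decay N γ x := by positivity
    linarith
  · have h3 : 1 ≤ (1 + |ρ|) ^ γ * decay N γ x := by
      rw [decay, Real.rpow_neg (by positivity), ← div_eq_mul_inv, one_le_div (by positivity)]
      exact Real.rpow_le_rpow (by positivity) (by linarith [le_abs_self ρ]) hγ
    have h4 : |u₀ x - A * decay N α x| ≤ |M| + A := by
      refine (abs_sub _ _).trans (add_le_add (hMx.trans (le_abs_self M)) ?_)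
      rw [abs_of_nonneg (by positivity)]
      exact mul_le_of_le_one_right hA (decay_le_one hα x)
    have h5 := mul_le_mul_of_nonneg_left h3 (show 0 ≤ |M| + A by positivity)
    have : 0 ≤ ε * decay N α x := by positivity
    linarith

/-! ### Spatial decay on bounded time intervals. -/

section Solution

variable {p : ℝ} {u₀ : EuclideanSpace ℝ (Fin N) → ℝ} {u : ℝ → EuclideanSpace ℝ (Fin N) → ℝ}

theorem IsSolution.initial_bounded (hu : IsSolution J p u₀ u) : ∃ M : ℝ, ∀ᵐ x, |u₀ x| ≤ M := by
  obtain ⟨M, hM⟩ := hu.locallyBounded 0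
  refine ⟨M, ?_⟩
  filter_upwards [hM 0 ⟨le_rfl, le_rfl⟩, hu.initial] with x h1 h2
  rwa [← h2]

theorem IsSolution.exists_initial_le (hu : IsSolution J p u₀ u) {α A : ℝ} (hα : 0 ≤ α)
    (hA : 0 ≤ A) (hlim : Tendsto (fun x => ‖x‖ ^ α * u₀ x) (essInfty N) (𝓝 A)) :
    ∃ C : ℝ, 0 ≤ C ∧ ∀ᵐ x, u 0 x ≤ C * decay N α x := by
  obtain ⟨M, hM⟩ := hu.initial_bounded
  obtain ⟨C, hC, h⟩ := exists_initial_bound hα hA hM hlim hα one_pos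
  refine ⟨A + 1 + C, by positivity, ?_⟩
  filter_upwards [h, hu.initial] with x hx hx0
  rw [hx0]
  linarith [le_abs_self (u₀ x - A * decay N α x)]

theorem IsSolution.exists_le_decay (hJ : IsKernel J) (hu : IsSolution J p u₀ u) {α A : ℝ}
    (hα : 0 ≤ α) (hA : 0 ≤ A)
    (hlim : Tendsto (fun x => ‖x‖ ^ α * u₀ x) (essInfty N) (𝓝 A)) (T : ℝ) :
    ∃ C : ℝ, 0 ≤ C ∧ ∀ᵐ x, ∀ t ∈ Icc 0 T, u t x ≤ C * decay N α x := by
  obtain ⟨C, hC, h0⟩ := hu.exists_initial_le hα hA hlim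
  obtain ⟨κ, hκ, hκ'⟩ := hJ.exists_kernelAvg_decay_le (N := N) hα
  obtain ⟨M, hM⟩ := hu.ae_bounded T
  refine ⟨Real.exp ((κ + 1) * T) * C, by positivity, ?_⟩
  have := hJ.le_exp_mul_weight (z := u) (W := fun x => C * decay N α x) (M := M) (M' := C) (T := T)
    hκ (fun t ht => hu.measurable t ht.1.le) ?_ hM ?_ ((aestronglyMeasurable_decay α).const_mul C)
    (fun x => mul_nonneg hC (decay_pos α x).le)
    (fun x => mul_le_of_le_one_right hC (decay_le_one hα x)) ?_ h0
  · simpa only [mul_assoc] using this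
  · filter_upwards [hu.continuousOn] with x hx using hx.mono Icc_subset_Ici_self
  · filter_upwards [hu.hasDerivAt hJ] with x hx t ht hpos
    refine ⟨_, ?_, hx t ht.1⟩
    have h1 : 0 ≤ |u t x| ^ (p - 1) * u t x := by positivity
    have h2 : 0 ≤ C * decay N α x := mul_nonneg hC (decay_pos α x).le
    linarith
  · intro x
    rw [kernelAvg_const_mul]
    linarith [mul_le_mul_of_nonneg_left (hκ' x) hC]

/-- On bounded time intervals the solution is `A (1 + |x|)^{-α}` up to a small multiple of that
weight and a faster decaying term. -/
theorem IsSolution.exists_abs_sub_decay_le (hJ : IsKernel J) (hu : IsSolution J p u₀ u)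
    (hu₀ : ∀ᵐ x, 0 ≤ u₀ x) (hp : 1 < p) {α A : ℝ} (hα : 0 < α) (hA : 0 ≤ A)
    (hlim : Tendsto (fun x => ‖x‖ ^ α * u₀ x) (essInfty N) (𝓝 A)) (T : ℝ) {ε : ℝ} (hε : 0 < ε) :
    ∃ δ : ℝ, 0 < δ ∧ ∃ C : ℝ, ∀ᵐ x, ∀ t ∈ Icc 0 T,
      |u t x - A * decay N α x| ≤ ε * decay N α x + C * decay N (α + δ) x := by
  -- `1` is the power gained by the residual of the weight, `α (p - 1)` the one gained by `u^p`.
  set δ := min 1 (α * (p - 1)) with hδ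
  have hδ0 : 0 < δ := lt_min one_pos (mul_pos hα (by linarith))
  have hαδ : 0 ≤ α + δ := by positivity
  refine ⟨δ, hδ0, ?_⟩
  obtain ⟨C₁, hC₁, hle⟩ := hu.exists_le_decay hJ hα.le hA hlim T
  obtain ⟨κ₁, hκ₁, hκ₁'⟩ := hJ.exists_kernelAvg_decay_le (N := N) hα.le
  obtain ⟨κ₂, hκ₂, hκ₂'⟩ := hJ.exists_kernelAvg_decay_le (N := N) hαδ
  obtain ⟨K, hK, hK'⟩ := hJ.exists_abs_kernelAvg_decay_sub_le (N := N) hα.le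
  obtain ⟨M, hM⟩ := hu.ae_bounded T
  obtain ⟨M₀, hM₀⟩ := hu.initial_bounded
  set κ := κ₁ + κ₂ with hκ
  set E := Real.exp ((κ + 1) * T) with hE
  have hE0 : 0 < E := Real.exp_pos _
  -- Dividing by `E` compensates in advance for the growth factor of the comparison on `[0, T]`.
  obtain ⟨C₂, hC₂, hinit⟩ := exists_initial_bound hα.le hA hM₀ hlim hαδ (div_pos hε hE0)
  set ε' := ε / E with hε'
  have hε'0 : 0 < ε' := by positivity
  -- The three terms cover the initial remainder, the residual of the weight and the absorption.
  set C₃ := C₂ + A * K + C₁ ^ p with hC₃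
  have hC₁p : 0 ≤ C₁ ^ p := by positivity
  have hC₃0 : 0 ≤ C₃ := by positivity
  set W : EuclideanSpace ℝ (Fin N) → ℝ := fun x => ε' * decay N α x + C₃ * decay N (α + δ) x
    with hW
  have hWm : AEStronglyMeasurable W volume :=
    ((aestronglyMeasurable_decay α).const_mul _).add ((aestronglyMeasurable_decay _).const_mul _)
  have hW0 : ∀ x, 0 ≤ W x := fun x =>
    add_nonneg (mul_nonneg hε'0.le (decay_pos _ x).le) (mul_nonneg hC₃0 (decay_pos _ x).le)
  have hWb : ∀ x, W x ≤ ε' + C₃ := fun x =>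
    add_le_add (mul_le_of_le_one_right hε'0.le (decay_le_one hα.le x))
      (mul_le_of_le_one_right hC₃0 (decay_le_one hαδ x))
  have hWκ : ∀ x, kernelAvg J W x ≤ κ * W x := by
    intro x
    have hd1 := decay_pos α x
    have hd2 := decay_pos (α + δ) x
    rw [hW, hJ.kernelAvg_add x ((aestronglyMeasurable_decay α).const_mul _)
      ((aestronglyMeasurable_decay _).const_mul _) (M := ε') (M' := C₃)
      (Eventually.of_forall fun y => ?_) (Eventually.of_forall fun y => ?_), kernelAvg_const_mul,
      kernelAvg_const_mul]
    · have h1 := mul_le_mul_of_nonneg_left (hκ₁' x) hε'0.le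
      have h2 := mul_le_mul_of_nonneg_left (hκ₂' x) hC₃0
      have h3 : 0 ≤ κ₂ * (ε' * decay N α x) := by positivity
      have h4 : 0 ≤ κ₁ * (C₃ * decay N (α + δ) x) := by positivity
      rw [hκ]
      linarith
    · rw [abs_of_nonneg (mul_nonneg hε'0.le (decay_pos _ y).le)]
      exact mul_le_of_le_one_right hε'0.le (decay_le_one hα.le y)
    · rw [abs_of_nonneg (mul_nonneg hC₃0 (decay_pos _ y).le)]
      exact mul_le_of_le_one_right hC₃0 (decay_le_one hαδ y)
  have hforce : ∀ᵐ x, ∀ t ∈ Icc 0 T, |A * (kernelAvg J (decay N α) x - decay N α x)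
      - |u t x| ^ (p - 1) * u t x| ≤ W x := by
    filter_upwards [hle, hu.nonneg hJ hu₀] with x hx hx0 t ht
    have hd := decay_pos α x
    have hd2 := decay_pos (α + δ) x
    have h0 := hx0 t ht.1
    have h1 : |u t x| ^ (p - 1) * u t x ≤ C₁ ^ p * decay N (α + δ) x := by
      rw [abs_of_nonneg h0, ← Real.rpow_add_one' h0 (by linarith), sub_add_cancel]
      calc u t x ^ p ≤ (C₁ * decay N α x) ^ p :=
            Real.rpow_le_rpow h0 (hx t ht) (by linarith)
        _ = C₁ ^ p * decay N (α * p) x := by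
            rw [Real.mul_rpow hC₁ hd.le, decay, ← Real.rpow_mul (by positivity), neg_mul]; rfl
        _ ≤ _ := by
            refine mul_le_mul_of_nonneg_left (decay_anti ?_ x) hC₁p
            have := min_le_right 1 (α * (p - 1))
            linarith
    have h2 : 0 ≤ |u t x| ^ (p - 1) * u t x := by positivity
    have h3 : |A * (kernelAvg J (decay N α) x - decay N α x)| ≤ A * K * decay N (α + δ) x := by
      rw [abs_mul, abs_of_nonneg hA, mul_assoc]
      refine mul_le_mul_of_nonneg_left ((hK' x).trans (mul_le_mul_of_nonneg_left ?_ hK)) hA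
      exact decay_anti (add_le_add_right (min_le_left _ _) _) x
    calc _ ≤ A * K * decay N (α + δ) x + C₁ ^ p * decay N (α + δ) x := by
          refine (abs_sub _ _).trans (add_le_add h3 ?_)
          rwa [abs_of_nonneg h2]
      _ ≤ W x := by
          have h4 : 0 ≤ ε' * decay N α x := by positivity
          have h5 : 0 ≤ C₂ * decay N (α + δ) x := by positivity
          simp only [hW, hC₃]
          linarith
  -- The difference solves a forced linear equation, so both signs `s = ±1` are treated alike.
  have hmain : ∀ s : ℝ, |s| = 1 → ∀ᵐ x, ∀ t ∈ Icc 0 T,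
      s * (u t x - A * decay N α x) ≤ E * W x := by
    intro s hs
    have hsle : ∀ a : ℝ, s * a ≤ |a| := fun a => by
      calc s * a ≤ |s * a| := le_abs_self _
        _ = |a| := by rw [abs_mul, hs, one_mul]
    have hAd : ∀ y, |A * decay N α y| ≤ A := fun y => by
      rw [abs_of_nonneg (mul_nonneg hA (decay_pos _ y).le)]
      exact mul_le_of_le_one_right hA (decay_le_one hα.le y)
    apply hJ.le_exp_mul_weight (M := M + A) (by positivity) _ _ _ _ hWm hW0 hWb hWκ _
    · exact fun t ht => ((hu.measurable t ht.1.le).sub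
        ((aestronglyMeasurable_decay α).const_mul A)).const_mul s
    · filter_upwards [hu.continuousOn] with x hx
      exact continuousOn_const.mul ((hx.mono Icc_subset_Ici_self).sub continuousOn_const)
    · filter_upwards [hM] with x hx t ht
      rw [abs_mul, hs, one_mul]
      exact (abs_sub _ _).trans (add_le_add (hx t ht) (hAd x))
    · filter_upwards [hu.hasDerivAt hJ, hforce] with x hx hfx t ht _
      refine ⟨_, ?_, ((hx t ht.1).sub_const _).const_mul s⟩
      have hMt : ∀ᵐ y, |u t y| ≤ M := by
        filter_upwards [hM] with y hy using hy t (Ioo_subset_Icc_self ht)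
      rw [kernelAvg_const_mul, hJ.kernelAvg_sub x (hu.measurable t ht.1.le)
        ((aestronglyMeasurable_decay α).const_mul A) hMt (Eventually.of_forall hAd),
        kernelAvg_const_mul]
      have h1 := (hsle _).trans (hfx t (Ioo_subset_Icc_self ht))
      linarith
    · filter_upwards [hinit, hu.initial] with x hx hx0
      rw [hx0]
      refine ((hsle _).trans hx).trans ?_
      have h4 : 0 ≤ (A * K + C₁ ^ p) * decay N (α + δ) x :=
        mul_nonneg (by positivity) (decay_pos _ x).le
      simp only [hW, hC₃]
      linarith
  refine ⟨E * C₃, ?_⟩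
  filter_upwards [hmain 1 (by simp), hmain (-1) (by simp)] with x h1 h2 t ht
  have h3 : E * W x = ε * decay N α x + E * C₃ * decay N (α + δ) x := by
    simp only [hW, hε']
    field_simp
  rw [← h3]
  exact abs_le.2 ⟨by linarith [h2 t ht], by linarith [h1 t ht]⟩

theorem IsSolution.tendstoUniformlyOn (hJ : IsKernel J) (hu : IsSolution J p u₀ u)
    (hu₀ : ∀ᵐ x, 0 ≤ u₀ x) (hp : 1 < p) {α A : ℝ} (hα : 0 < α) (hA : 0 ≤ A)
    (hlim : Tendsto (fun x => ‖x‖ ^ α * u₀ x) (essInfty N) (𝓝 A)) (T : ℝ) :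
    TendstoUniformlyOn (fun x t => ‖x‖ ^ α * u t x) (fun _ => A) (essInfty N) (Icc 0 T) := by
  rw [Metric.tendstoUniformlyOn_iff]
  intro ε hε
  obtain ⟨δ, hδ, C, hC⟩ := hu.exists_abs_sub_decay_le hJ hu₀ hp hα hA hlim T
    (show 0 < ε / 2 by positivity)
  have h1 : Tendsto (fun x => A * |‖x‖ ^ α * decay N α x - 1|
      + (ε / 2 + C * decay N δ x) * (‖x‖ ^ α * decay N α x)) (essInfty N) (𝓝 (ε / 2)) := by
    have ha := (tendsto_norm_rpow_mul_decay (N := N) α).mono_left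
      (inf_le_left : essInfty N ≤ _)
    have hb := (tendsto_decay (N := N) hδ).mono_left (inf_le_left : essInfty N ≤ _)
    have := (((ha.sub_const 1).abs).const_mul A).add
      (((hb.const_mul C).const_add (ε / 2)).mul ha)
    have h0 : A * |1 - 1| + (ε / 2 + C * 0) * 1 = ε / 2 := by simp
    rwa [h0] at this
  have hev := h1.eventually_lt_const (show ε / 2 < ε by linarith)
  have hC' : ∀ᶠ x in essInfty N, ∀ t ∈ Icc 0 T, |u t x - A * decay N α x|
      ≤ ε / 2 * decay N α x + C * decay N (α + δ) x := hC.filter_mono inf_le_right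
  filter_upwards [hev, hC'] with x hx hCx t ht
  rw [dist_comm, Real.dist_eq]
  have hn : 0 ≤ ‖x‖ ^ α := by positivity
  have h2 : ‖x‖ ^ α * u t x - A = A * (‖x‖ ^ α * decay N α x - 1)
      + ‖x‖ ^ α * (u t x - A * decay N α x) := by ring
  rw [h2]
  refine lt_of_le_of_lt ?_ hx
  refine (abs_add_le _ _).trans (add_le_add ?_ ?_)
  · rw [abs_mul, abs_of_nonneg hA]
  · rw [abs_mul, abs_of_nonneg hn]
    refine (mul_le_mul_of_nonneg_left (hCx t ht) hn).trans (le_of_eq ?_)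
    rw [decay_add]
    ring

end Solution

/-! ### Moments of the kernel and second order expansion. -/

/-- The second moment of a kernel. -/
noncomputable def secondMoment (J : EuclideanSpace ℝ (Fin N) → ℝ) : ℝ := ∫ z, J z * ‖z‖ ^ 2

theorem IsKernel.integrable_mul (hJ : IsKernel J) {g : EuclideanSpace ℝ (Fin N) → ℝ}
    (hg : Continuous g) : Integrable (fun z => J z * g z) :=
  (hJ.smooth.continuous.mul hg).integrable_of_hasCompactSupport hJ.compactSupport.mul_right

theorem IsKernel.integral_mul_odd (hJ : IsKernel J) {g : EuclideanSpace ℝ (Fin N) → ℝ}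
    (hg : ∀ z, g (-z) = -g z) : ∫ z, J z * g z = 0 := by
  have h := integral_neg_eq_self (fun z => J z * g z) volume
  simp only [hg, hJ.radial (-_) _ (norm_neg _), mul_neg, integral_neg] at h
  linarith

theorem IsKernel.secondMoment_pos (hJ : IsKernel J) (hN : 1 ≤ N) : 0 < secondMoment J := by
  have : Nonempty (Fin N) := ⟨⟨0, hN⟩⟩
  have hnn : ∀ z, 0 ≤ J z * ‖z‖ ^ 2 := fun z => mul_nonneg (hJ.nonneg z) (by positivity)
  refine lt_of_le_of_ne (integral_nonneg hnn) fun h => ?_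
  have h0 := (integral_eq_zero_iff_of_nonneg hnn (hJ.integrable_mul (by fun_prop))).1 h.symm
  have hJ0 : J =ᵐ[volume] 0 := by
    filter_upwards [h0, Measure.ae_ne volume (0 : EuclideanSpace ℝ (Fin N))] with z hz hz0
    have : ‖z‖ ^ 2 ≠ 0 := by simpa using hz0
    exact (mul_eq_zero.1 hz).resolve_right this
  have := hJ.integral_eq_one
  rw [integral_congr_ae hJ0] at this
  simp at this

/-- The reflection exchanging `x` and `y` preserves both Lebesgue measure and the radial `J`. -/
theorem IsKernel.integral_mul_inner_sq_congr (hJ : IsKernel J)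
    {x y : EuclideanSpace ℝ (Fin N)} (hxy : ‖x‖ = ‖y‖) :
    ∫ z, J z * inner ℝ x z ^ 2 = ∫ z, J z * inner ℝ y z ^ 2 := by
  set L := (Submodule.span ℝ {x - y})ᗮ.reflection with hL
  have hLx : L x = y := Submodule.reflection_sub hxy
  have h := L.measurePreserving.integral_comp L.toHomeomorph.measurableEmbedding
    (fun z => J z * inner ℝ y z ^ 2)
  rw [← h]
  refine integral_congr_ae (Eventually.of_forall fun z => ?_)
  have h1 : J (L z) = J z := hJ.radial _ _ (L.norm_map z)
  have h2 : inner ℝ y (L z) = inner ℝ x z := by rw [← hLx, L.inner_map_map]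
  simp only [h1, h2]

/-- By isotropy `x` may be replaced by `|x|` times any coordinate vector; summing over the `N` axes
produces the second moment. -/
theorem IsKernel.integral_mul_inner_sq (hJ : IsKernel J) (hN : 1 ≤ N)
    (x : EuclideanSpace ℝ (Fin N)) :
    ∫ z, J z * inner ℝ x z ^ 2 = ‖x‖ ^ 2 * (secondMoment J / N) := by
  have hi : ∀ i : Fin N, ∫ z, J z * inner ℝ x z ^ 2 = ‖x‖ ^ 2 * ∫ z, J z * z i ^ 2 := by
    intro i
    rw [hJ.integral_mul_inner_sq_congr (y := EuclideanSpace.single i ‖x‖) (by simp),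
      ← integral_const_mul]
    refine integral_congr_ae (Eventually.of_forall fun z => ?_)
    simp only [EuclideanSpace.inner_single_left, conj_trivial]
    ring
  have hsum : ∑ i : Fin N, ∫ z, J z * z i ^ 2 = secondMoment J := by
    rw [← integral_finsetSum _ fun i _ => hJ.integrable_mul (by fun_prop)]
    simp only [secondMoment, ← Finset.mul_sum, EuclideanSpace.real_norm_sq_eq]
  have hN0 : (N : ℝ) ≠ 0 := by positivity
  have h2 : (N : ℝ) * ∫ z, J z * inner ℝ x z ^ 2 = ‖x‖ ^ 2 * secondMoment J := by
    rw [← hsum, Finset.mul_sum, ← Finset.sum_congr rfl fun i _ => hi i]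
    simp
  field_simp
  linarith

/-- Here `|z|² - 2⟨x, z⟩ = |x - z|² - |x|²` is the increment in a Taylor polynomial of a function of
`|x|²`; the terms odd in `z` integrate to zero. -/
theorem IsKernel.integral_mul_quadratic (hJ : IsKernel J) (hN : 1 ≤ N)
    (x : EuclideanSpace ℝ (Fin N)) (c₀ c₁ c₂ : ℝ) :
    ∫ z, J z * (c₀ + c₁ * (‖z‖ ^ 2 - 2 * inner ℝ x z) + c₂ * (‖z‖ ^ 2 - 2 * inner ℝ x z) ^ 2)
      = c₀ + c₁ * secondMoment J
        + c₂ * ((∫ z, J z * ‖z‖ ^ 4) + 4 * (‖x‖ ^ 2 * (secondMoment J / N))) := by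
  have hodd : ∫ z, J z * (-2 * c₁ * inner ℝ x z - 4 * c₂ * ‖z‖ ^ 2 * inner ℝ x z) = 0 :=
    hJ.integral_mul_odd fun z => by simp only [inner_neg_right, norm_neg]; ring
  have i0 := hJ.integrable.mul_const c₀
  have i1 := (hJ.integrable_mul (g := fun z => ‖z‖ ^ 2) (by fun_prop)).mul_const c₁
  have i2 := (hJ.integrable_mul (g := fun z => ‖z‖ ^ 4) (by fun_prop)).mul_const c₂
  have i3 := (hJ.integrable_mul (g := fun z => inner ℝ x z ^ 2) (by fun_prop)).mul_const (4 * c₂)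
  have i4 := hJ.integrable_mul
    (g := fun z => -2 * c₁ * inner ℝ x z - 4 * c₂ * ‖z‖ ^ 2 * inner ℝ x z) (by fun_prop)
  have hsplit : ∀ z, J z * (c₀ + c₁ * (‖z‖ ^ 2 - 2 * inner ℝ x z)
      + c₂ * (‖z‖ ^ 2 - 2 * inner ℝ x z) ^ 2)
      = J z * c₀ + J z * ‖z‖ ^ 2 * c₁ + J z * ‖z‖ ^ 4 * c₂ + J z * inner ℝ x z ^ 2 * (4 * c₂)
        + J z * (-2 * c₁ * inner ℝ x z - 4 * c₂ * ‖z‖ ^ 2 * inner ℝ x z) := fun z => by ring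
  simp only [hsplit]
  have i01 : Integrable (fun z => J z * c₀ + J z * ‖z‖ ^ 2 * c₁) := i0.add i1
  have i012 : Integrable (fun z => J z * c₀ + J z * ‖z‖ ^ 2 * c₁ + J z * ‖z‖ ^ 4 * c₂) :=
    i01.add i2
  have i0123 : Integrable (fun z => J z * c₀ + J z * ‖z‖ ^ 2 * c₁ + J z * ‖z‖ ^ 4 * c₂
      + J z * inner ℝ x z ^ 2 * (4 * c₂)) := i012.add i3
  rw [integral_add i0123 i4, integral_add i012 i3, integral_add i01 i2, integral_add i0 i1, hodd]
  simp only [integral_mul_const]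
  rw [hJ.integral_mul_inner_sq hN, hJ.integral_eq_one, secondMoment]
  ring

/-- Three applications of the mean value inequality; the sharp factor `1/6` is not needed. The
unordered interval allows increments of either sign. -/
theorem taylor_two_le {f f₁ f₂ f₃ : ℝ → ℝ} {a b B : ℝ}
    (h₁ : ∀ r ∈ uIcc a b, HasDerivAt f (f₁ r) r) (h₂ : ∀ r ∈ uIcc a b, HasDerivAt f₁ (f₂ r) r)
    (h₃ : ∀ r ∈ uIcc a b, HasDerivAt f₂ (f₃ r) r) (hB : ∀ r ∈ uIcc a b, |f₃ r| ≤ B) :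
    f b ≤ f a + f₁ a * (b - a) + f₂ a / 2 * (b - a) ^ 2 + B * |b - a| ^ 3 := by
  have hconv : Convex ℝ (uIcc a b) := convex_uIcc a b
  have hB0 : 0 ≤ B := (abs_nonneg _).trans (hB a left_mem_uIcc)
  have hd : ∀ r ∈ uIcc a b, |r - a| ≤ |b - a| := fun r hr => abs_sub_left_of_mem_uIcc hr
  have e₂ : ∀ r ∈ uIcc a b, |f₂ r - f₂ a| ≤ B * |b - a| := by
    intro r hr
    have := hconv.norm_image_sub_le_of_norm_hasDerivWithin_le
      (fun s hs => (h₃ s hs).hasDerivWithinAt) hB left_mem_uIcc hr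
    exact this.trans (mul_le_mul_of_nonneg_left (hd r hr) hB0)
  have e₁ : ∀ r ∈ uIcc a b, |f₁ r - f₁ a - f₂ a * (r - a)| ≤ B * |b - a| ^ 2 := by
    intro r hr
    have := hconv.norm_image_sub_le_of_norm_hasDerivWithin_le
      (f := fun s => f₁ s - f₂ a * (s - a)) (f' := fun s => f₂ s - f₂ a)
      (fun s hs => by
        have := (h₂ s hs).sub (((hasDerivAt_id s).sub_const a).const_mul (f₂ a))
        exact (this.congr_deriv (by simp)).hasDerivWithinAt) e₂ left_mem_uIcc hr
    simp only [sub_self, mul_zero, sub_zero, Real.norm_eq_abs] at this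
    calc |f₁ r - f₁ a - f₂ a * (r - a)| = |f₁ r - f₂ a * (r - a) - f₁ a| := by congr 1; ring
      _ ≤ B * |b - a| * |r - a| := this
      _ ≤ B * |b - a| * |b - a| := mul_le_mul_of_nonneg_left (hd r hr) (by positivity)
      _ = _ := by ring
  have := hconv.norm_image_sub_le_of_norm_hasDerivWithin_le
    (f := fun s => f s - f₁ a * (s - a) - f₂ a / 2 * (s - a) ^ 2)
    (f' := fun s => f₁ s - f₁ a - f₂ a * (s - a))
    (fun s hs => by
      have := ((h₁ s hs).sub (((hasDerivAt_id s).sub_const a).const_mul (f₁ a))).sub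
        ((((hasDerivAt_id s).sub_const a).pow 2).const_mul (f₂ a / 2))
      refine (this.congr_deriv ?_).hasDerivWithinAt
      simp only [id_eq]
      ring) e₁ left_mem_uIcc right_mem_uIcc
  simp only [sub_self, mul_zero, sub_zero, Real.norm_eq_abs, ne_eq, OfNat.ofNat_ne_zero,
    not_false_eq_true, zero_pow] at this
  have h4 := (le_abs_self _).trans this
  have h5 : B * |b - a| ^ 2 * |b - a| = B * |b - a| ^ 3 := by ring
  linarith

/-! ### Inverse powers of the similarity variable. -/

/-- The power `(1 + r)^{-b}`. -/
noncomputable def invPow (b r : ℝ) : ℝ := (1 + r) ^ (-b)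

theorem invPow_pos (b : ℝ) {r : ℝ} (hr : 0 ≤ r) : 0 < invPow b r := by
  unfold invPow; positivity

theorem invPow_eq_mul (b : ℝ) {r : ℝ} (hr : 0 ≤ r) :
    invPow b r = invPow (b + 1) r * (1 + r) := by
  have h : -b = -(b + 1) + 1 := by ring
  rw [invPow, invPow, h, Real.rpow_add_one (by positivity)]

theorem invPow_le_one {b r : ℝ} (hb : 0 ≤ b) (hr : 0 ≤ r) : invPow b r ≤ 1 :=
  Real.rpow_le_one_of_one_le_of_nonpos (by linarith) (by linarith)

theorem invPow_succ_le (b : ℝ) {r : ℝ} (hr : 0 ≤ r) : invPow (b + 1) r ≤ invPow b r := by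
  rw [invPow_eq_mul b hr]
  nlinarith [invPow_pos (b + 1) hr]

theorem invPow_le_of_le {b r s : ℝ} (hb : 0 ≤ b) (hr : 0 ≤ r) (h : (1 + r) / 2 ≤ 1 + s) :
    invPow b s ≤ 2 ^ b * invPow b r := by
  have h1 : ((1 + r) / 2) ^ (-b) = 2 ^ b * invPow b r := by
    rw [Real.div_rpow (by positivity) (by norm_num), invPow, Real.rpow_neg (x := 2) (by norm_num),
      div_inv_eq_mul, mul_comm]
  rw [← h1]
  exact Real.rpow_le_rpow_of_nonpos (by positivity) h (by linarith)

theorem hasDerivAt_invPow (b : ℝ) {r : ℝ} (hr : 0 ≤ r) :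
    HasDerivAt (invPow b) (-b * invPow (b + 1) r) r := by
  have h := ((hasDerivAt_id r).const_add 1).rpow_const (p := -b) (Or.inl (by simp; positivity))
  refine h.congr_deriv ?_
  rw [invPow, show -b - 1 = -(b + 1) by ring]
  simp

/-- Raise `y ≤ e^y` at `y = (1 + r) / b` to the power `b`. -/
theorem exp_neg_le_invPow {b r : ℝ} (hb : 0 < b) (hr : 0 ≤ r) :
    Real.exp (-r) ≤ b ^ b * Real.exp 1 * invPow b r := by
  have h1 : (1 + r) / b ≤ Real.exp ((1 + r) / b) := by
    linarith [Real.add_one_le_exp ((1 + r) / b)]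
  have h2 : (1 + r) ^ b ≤ b ^ b * Real.exp (1 + r) := by
    have := Real.rpow_le_rpow (by positivity) h1 hb.le
    rw [← Real.exp_mul, div_mul_cancel₀ _ hb.ne', Real.div_rpow (by positivity) hb.le,
      div_le_iff₀ (by positivity)] at this
    linarith
  have h3 : 0 < (1 + r) ^ b := by positivity
  rw [invPow, Real.rpow_neg (by positivity), ← div_eq_mul_inv, le_div_iff₀ h3]
  calc Real.exp (-r) * (1 + r) ^ b ≤ Real.exp (-r) * (b ^ b * Real.exp (1 + r)) :=
        mul_le_mul_of_nonneg_left h2 (Real.exp_nonneg _)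
    _ = b ^ b * (Real.exp (-r) * Real.exp (1 + r)) := by ring
    _ = b ^ b * Real.exp 1 := by rw [← Real.exp_add]; congr 2; ring

/-- Makes inverse powers comparable along the whole Taylor segment, at the cost of a factor `2 ^ b`.
-/
theorem half_one_add_norm_sq_div_le {x z : EuclideanSpace ℝ (Fin N)} {R τ : ℝ} (hz : ‖z‖ ≤ R)
    (hτ0 : 0 < τ) (hτ : 2 * R ^ 2 ≤ τ) :
    (1 + ‖x‖ ^ 2 / τ) / 2 ≤ 1 + ‖x - z‖ ^ 2 / τ := by
  have h1 : ‖x‖ ≤ ‖x - z‖ + R := by linarith [norm_sub_norm_le x z]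
  have h2 : ‖x‖ ^ 2 ≤ (‖x - z‖ + R) ^ 2 := by gcongr
  have h3 : ‖x‖ ^ 2 ≤ 2 * ‖x - z‖ ^ 2 + τ := by nlinarith [sq_nonneg (‖x - z‖ - R)]
  have h4 : ‖x‖ ^ 2 / τ ≤ 2 * (‖x - z‖ ^ 2 / τ) + 1 := by
    rw [div_le_iff₀ hτ0]
    have : (2 * (‖x - z‖ ^ 2 / τ) + 1) * τ = 2 * ‖x - z‖ ^ 2 + τ := by field_simp
    linarith
  linarith

theorem abs_norm_sub_sq_sub_le {x z : EuclideanSpace ℝ (Fin N)} {R L : ℝ} (hz : ‖z‖ ≤ R)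
    (hL : 1 ≤ L) (hx : ‖x‖ ≤ L) :
    |‖z‖ ^ 2 - 2 * inner ℝ x z| ≤ (R ^ 2 + 2 * R) * L := by
  have hR : 0 ≤ R := (norm_nonneg _).trans hz
  have hin : |inner ℝ x z| ≤ L * R :=
    (abs_real_inner_le_norm x z).trans (mul_le_mul hx hz (norm_nonneg _) (by linarith))
  have hz2 : ‖z‖ ^ 2 ≤ R ^ 2 := by gcongr
  have h4 : R ^ 2 * 1 ≤ R ^ 2 * L := by gcongr
  have h5 := abs_le.1 hin
  refine abs_le.2 ⟨by linarith [sq_nonneg ‖z‖, mul_nonneg (sq_nonneg R) (zero_le_one.trans hL)],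
    by linarith⟩

/-- Second order consistency of `v ↦ J * v` with the Laplacian on functions `f(|x|²/τ)` whose
derivatives decay algebraically. -/
theorem IsKernel.exists_kernelAvg_radial_le (hJ : IsKernel J) (hN : 1 ≤ N) {β : ℝ} (hβ : 0 ≤ β) :
    ∃ C τ₀ : ℝ, 0 ≤ C ∧ 1 ≤ τ₀ ∧ ∀ (f f₁ f₂ f₃ : ℝ → ℝ) (K : ℝ), 0 ≤ K →
      (∀ r, 0 ≤ r → HasDerivAt f (f₁ r) r) → (∀ r, 0 ≤ r → HasDerivAt f₁ (f₂ r) r) →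
      (∀ r, 0 ≤ r → HasDerivAt f₂ (f₃ r) r) →
      (∀ r, 0 ≤ r → |f₂ r| ≤ K * invPow (β + 1 + 1) r) →
      (∀ r, 0 ≤ r → |f₃ r| ≤ K * invPow (β + 1 + 1 + 1) r) →
      ∀ τ, τ₀ ≤ τ → ∀ x, kernelAvg J (fun y => f (‖y‖ ^ 2 / τ)) x ≤ f (‖x‖ ^ 2 / τ)
        + secondMoment J / τ * (f₁ (‖x‖ ^ 2 / τ) + 2 / N * (‖x‖ ^ 2 / τ) * f₂ (‖x‖ ^ 2 / τ))
        + C * K / √τ ^ 3 * invPow (β + 1) (‖x‖ ^ 2 / τ) := by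
  obtain ⟨R, hR1, hR⟩ := hJ.exists_radius
  set D := R ^ 2 + 2 * R with hD
  set m₄ := ∫ z, J z * ‖z‖ ^ 4 with hm₄
  have hm₄0 : 0 ≤ m₄ := integral_nonneg fun z => mul_nonneg (hJ.nonneg z) (by positivity)
  refine ⟨2 ^ (β + 1 + 1 + 1) * D ^ 3 + m₄, 2 * R ^ 2, by positivity, by nlinarith, ?_⟩
  intro f f₁ f₂ f₃ K hK h₁ h₂ h₃ hb₂ hb₃ τ hτ x
  have hτ1 : 1 ≤ τ := le_trans (by nlinarith) hτ
  have hτ0 : 0 < τ := by linarith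
  set r := ‖x‖ ^ 2 / τ with hr
  have hr0 : 0 ≤ r := by positivity
  set σ := √τ with hσ
  have hσ1 : 1 ≤ σ := Real.one_le_sqrt.2 hτ1
  have hσ0 : 0 < σ := by linarith
  have hσ2 : σ ^ 2 = τ := Real.sq_sqrt hτ0.le
  set q := √(1 + r) with hq
  have hq1 : 1 ≤ q := Real.one_le_sqrt.2 (by linarith)
  have hq2 : q ^ 2 = 1 + r := Real.sq_sqrt (by linarith)
  have hxq : ‖x‖ ≤ σ * q := by
    apply abs_le_of_sq_le_sq' _ (by positivity) |>.2
    rw [mul_pow, hσ2, hq2, hr]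
    field_simp
    linarith
  set P := invPow (β + 1 + 1 + 1) r with hP
  have hP0 : 0 < P := invPow_pos _ hr0
  have hP2 : invPow (β + 1 + 1) r = P * (1 + r) := invPow_eq_mul _ hr0
  have hP1 : invPow (β + 1) r = P * (1 + r) ^ 2 := by
    rw [invPow_eq_mul _ hr0, hP2]; ring
  -- The cubic remainder: the increment of `r` is at most `D q / σ`. Later `q ^ 3 ≤ (1 + r) ^ 2`
  -- trades `q ^ 3 * P` for `invPow (β + 1) r`.
  set Err := K * 2 ^ (β + 1 + 1 + 1) * P * (D * q / σ) ^ 3 with hErr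
  have hpt : ∀ z, J z * f (‖x - z‖ ^ 2 / τ) ≤ J z * ((f r + Err)
      + f₁ r / τ * (‖z‖ ^ 2 - 2 * inner ℝ x z)
      + f₂ r / (2 * τ ^ 2) * (‖z‖ ^ 2 - 2 * inner ℝ x z) ^ 2) := by
    intro z
    by_cases hz : J z = 0
    · simp [hz]
    refine mul_le_mul_of_nonneg_left ?_ (hJ.nonneg z)
    have hzR := hR z hz
    set r' := ‖x - z‖ ^ 2 / τ with hr'
    have hr'0 : 0 ≤ r' := by positivity
    have hdiff : r' - r = (‖z‖ ^ 2 - 2 * inner ℝ x z) / τ := by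
      rw [hr', hr, norm_sub_sq_real]; ring
    have habs : |r' - r| ≤ D * q / σ := by
      have h1 : |‖z‖ ^ 2 - 2 * inner ℝ x z| ≤ D * (σ * q) :=
        abs_norm_sub_sq_sub_le hzR (one_le_mul_of_one_le_of_one_le hσ1 hq1) hxq
      rw [hdiff, abs_div, abs_of_pos hτ0, div_le_div_iff₀ hτ0 hσ0, ← hσ2]
      calc |‖z‖ ^ 2 - 2 * inner ℝ x z| * σ ≤ D * (σ * q) * σ := by gcongr
        _ = D * q * σ ^ 2 := by ring
    have hhalf : ∀ s ∈ uIcc r r', 0 ≤ s ∧ (1 + r) / 2 ≤ 1 + s := by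
      intro s hs
      have hmin : min r r' ≤ s := hs.1
      have hr'half : (1 + r) / 2 ≤ 1 + r' := half_one_add_norm_sq_div_le hzR hτ0 hτ
      rcases min_le_iff.1 hmin with h | h
      · exact ⟨hr0.trans h, by linarith⟩
      · exact ⟨hr'0.trans h, by linarith⟩
    have ht := taylor_two_le (a := r) (b := r') (B := K * 2 ^ (β + 1 + 1 + 1) * P)
      (fun s hs => h₁ s (hhalf s hs).1) (fun s hs => h₂ s (hhalf s hs).1)
      (fun s hs => h₃ s (hhalf s hs).1) (fun s hs => by
        refine (hb₃ s (hhalf s hs).1).trans ?_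
        rw [mul_assoc]
        exact mul_le_mul_of_nonneg_left (invPow_le_of_le (by positivity) hr0 (hhalf s hs).2) hK)
    have herr : K * 2 ^ (β + 1 + 1 + 1) * P * |r' - r| ^ 3 ≤ Err := by
      rw [hErr]; gcongr
    rw [hdiff] at ht herr
    calc f r' ≤ _ := ht
      _ ≤ f r + f₁ r * ((‖z‖ ^ 2 - 2 * inner ℝ x z) / τ)
          + f₂ r / 2 * ((‖z‖ ^ 2 - 2 * inner ℝ x z) / τ) ^ 2 + Err := by gcongr
      _ = _ := by field_simp; ring
  have hcont : Continuous fun z => f (‖x - z‖ ^ 2 / τ) := by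
    have hf : ContinuousOn f (Ici 0) := fun s hs => (h₁ s hs).continuousAt.continuousWithinAt
    exact hf.comp_continuous (by fun_prop) fun z => mem_Ici.2 (by positivity)
  have hshift : kernelAvg J (fun y => f (‖y‖ ^ 2 / τ)) x = ∫ z, J z * f (‖x - z‖ ^ 2 / τ) := by
    have := integral_sub_left_eq_self (fun z => J z * f (‖x - z‖ ^ 2 / τ)) volume x
    simpa [kernelAvg] using this
  rw [hshift]
  refine (integral_mono (hJ.integrable_mul hcont) (hJ.integrable_mul (by fun_prop)) hpt).trans ?_
  rw [hJ.integral_mul_quadratic hN]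
  have hErr' : Err ≤ 2 ^ (β + 1 + 1 + 1) * D ^ 3 * K / σ ^ 3 * invPow (β + 1) r := by
    have hq3 : q ^ 3 ≤ (1 + r) ^ 2 := by
      rw [← hq2, ← pow_mul]
      exact pow_le_pow_right₀ hq1 (by norm_num)
    have : Err = 2 ^ (β + 1 + 1 + 1) * D ^ 3 * K / σ ^ 3 * (P * q ^ 3) := by
      rw [hErr]; field_simp
    rw [this, hP1]
    gcongr
  -- The fourth moment term is of order `τ^{-2}`, hence of lower order than the remainder
  -- `τ^{-3/2}`.
  have hfour : f₂ r / (2 * τ ^ 2) * m₄ ≤ m₄ * K / σ ^ 3 * invPow (β + 1) r := by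
    have h1 : f₂ r ≤ K * (P * (1 + r)) := by
      rw [← hP2]; exact (le_abs_self _).trans (hb₂ r hr0)
    have h2 : σ ^ 3 ≤ 2 * τ ^ 2 := by
      rw [← hσ2, ← pow_mul]
      have : σ ^ 3 ≤ σ ^ (2 * 2) := pow_le_pow_right₀ hσ1 (by norm_num)
      have : 0 ≤ σ ^ (2 * 2) := by positivity
      linarith
    have h3 : 1 + r ≤ (1 + r) ^ 2 := by nlinarith
    calc f₂ r / (2 * τ ^ 2) * m₄ ≤ K * (P * (1 + r)) / (2 * τ ^ 2) * m₄ := by gcongr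
      _ ≤ K * (P * (1 + r) ^ 2) / σ ^ 3 * m₄ := by gcongr
      _ = _ := by rw [hP1]; ring
  have hmain : f₁ r / τ * secondMoment J + f₂ r / (2 * τ ^ 2) *
      (4 * (‖x‖ ^ 2 * (secondMoment J / N)))
      = secondMoment J / τ * (f₁ r + 2 / N * r * f₂ r) := by
    have : (N : ℝ) ≠ 0 := by positivity
    rw [hr]
    field_simp
    ring
  have hsplit : (2 ^ (β + 1 + 1 + 1) * D ^ 3 + m₄) * K / σ ^ 3 * invPow (β + 1) r
      = 2 ^ (β + 1 + 1 + 1) * D ^ 3 * K / σ ^ 3 * invPow (β + 1) r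
        + m₄ * K / σ ^ 3 * invPow (β + 1) r := by ring
  rw [hsplit, ← hmain]
  linarith

/-! ### Self-similar supersolutions. -/

/-- The radial profile of the supersolutions, as a function of the similarity variable. -/
noncomputable def profile (β C a r : ℝ) : ℝ :=
  a * Real.exp (-r) + (invPow β r + C * invPow (β + 1) r)

/-- The first derivative of `profile`. -/
noncomputable def profileD1 (β C a r : ℝ) : ℝ :=
  -a * Real.exp (-r) + (-β * invPow (β + 1) r + C * (-(β + 1) * invPow (β + 1 + 1) r))

/-- The second derivative of `profile`. -/
noncomputable def profileD2 (β C a r : ℝ) : ℝ :=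
  a * Real.exp (-r) + (β * (β + 1) * invPow (β + 1 + 1) r
    + C * ((β + 1) * (β + 1 + 1) * invPow (β + 1 + 1 + 1) r))

/-- The third derivative of `profile`. -/
noncomputable def profileD3 (β C a r : ℝ) : ℝ :=
  -a * Real.exp (-r) + (-(β * (β + 1) * (β + 1 + 1)) * invPow (β + 1 + 1 + 1) r
    + C * (-((β + 1) * (β + 1 + 1) * (β + 1 + 1 + 1)) * invPow (β + 1 + 1 + 1 + 1) r))

theorem hasDerivAt_exp_neg (r : ℝ) : HasDerivAt (fun s => Real.exp (-s)) (-Real.exp (-r)) r :=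
  ((hasDerivAt_id r).neg.exp).congr_deriv (by simp)

theorem hasDerivAt_profile (β C a : ℝ) {r : ℝ} (hr : 0 ≤ r) :
    HasDerivAt (profile β C a) (profileD1 β C a r) r :=
  (((hasDerivAt_exp_neg r).const_mul a).add ((hasDerivAt_invPow β hr).add
    ((hasDerivAt_invPow (β + 1) hr).const_mul C))).congr_deriv (by rw [profileD1]; ring)

theorem hasDerivAt_profileD1 (β C a : ℝ) {r : ℝ} (hr : 0 ≤ r) :
    HasDerivAt (profileD1 β C a) (profileD2 β C a r) r :=
  (((hasDerivAt_exp_neg r).const_mul (-a)).add (((hasDerivAt_invPow (β + 1) hr).const_mul (-β)).add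
    (((hasDerivAt_invPow (β + 1 + 1) hr).const_mul (-(β + 1))).const_mul C))).congr_deriv
    (by rw [profileD2]; ring)

theorem hasDerivAt_profileD2 (β C a : ℝ) {r : ℝ} (hr : 0 ≤ r) :
    HasDerivAt (profileD2 β C a) (profileD3 β C a r) r :=
  (((hasDerivAt_exp_neg r).const_mul a).add
    (((hasDerivAt_invPow (β + 1 + 1) hr).const_mul (β * (β + 1))).add
    (((hasDerivAt_invPow (β + 1 + 1 + 1) hr).const_mul
      ((β + 1) * (β + 1 + 1))).const_mul C))).congr_deriv
    (by rw [profileD3]; ring)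

theorem profile_nonneg (β : ℝ) {C a r : ℝ} (hC : 0 ≤ C) (ha : 0 ≤ a) (hr : 0 ≤ r) :
    0 ≤ profile β C a r := by
  have := invPow_pos β hr
  have := invPow_pos (β + 1) hr
  unfold profile
  positivity

theorem profile_le {β C a r : ℝ} (hβ : 0 ≤ β) (hC : 0 ≤ C) (ha : 0 ≤ a) (hr : 0 ≤ r) :
    profile β C a r ≤ a + (1 + C) := by
  have h1 : a * Real.exp (-r) ≤ a :=
    mul_le_of_le_one_right ha (Real.exp_le_one_iff.2 (by linarith))
  have h2 := invPow_le_one hβ hr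
  have h3 := mul_le_of_le_one_right hC (invPow_le_one (by linarith : 0 ≤ β + 1) hr)
  unfold profile
  linarith

theorem continuous_profile_comp (β C a : ℝ) {X : Type*} [TopologicalSpace X] {h : X → ℝ}
    (hc : Continuous h) (h0 : ∀ x, 0 ≤ h x) : Continuous fun x => profile β C a (h x) :=
  ContinuousOn.comp_continuous (s := Ici 0)
    (fun _ hs => (hasDerivAt_profile β C a hs).continuousAt.continuousWithinAt) hc h0

theorem exists_profile_deriv_bounds {β C : ℝ} (hβ : 0 ≤ β) (hC : 0 ≤ C) :
    ∃ K : ℝ, 0 ≤ K ∧ ∀ a r : ℝ, 0 ≤ a → 0 ≤ r →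
      |profileD2 β C a r| ≤ K * (a + 1) * invPow (β + 1 + 1) r ∧
      |profileD3 β C a r| ≤ K * (a + 1) * invPow (β + 1 + 1 + 1) r := by
  set c := β + 1 + 1 + 1 with hc
  have hc0 : 0 < c := by positivity
  set E := c ^ c * Real.exp 1 with hE
  have hE0 : 0 ≤ E := by positivity
  set k₂ := β * (β + 1) + C * ((β + 1) * (β + 1 + 1)) with hk₂
  set k₃ := β * (β + 1) * (β + 1 + 1) + C * ((β + 1) * (β + 1 + 1) * c) with hk₃
  have hk₂0 : 0 ≤ k₂ := by positivity
  have hk₃0 : 0 ≤ k₃ := by positivity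
  refine ⟨E + k₂ + k₃, by positivity, fun a r ha hr => ?_⟩
  have hexp : Real.exp (-r) ≤ E * invPow c r := exp_neg_le_invPow hc0 hr
  have p2 := invPow_pos (β + 1 + 1) hr
  have p3 : 0 < invPow c r := invPow_pos c hr
  have p4 := invPow_pos (c + 1) hr
  have l3 : invPow c r ≤ invPow (β + 1 + 1) r := invPow_succ_le _ hr
  have l4 : invPow (c + 1) r ≤ invPow c r := invPow_succ_le _ hr
  have he := Real.exp_pos (-r)
  constructor
  · have h0 : 0 ≤ profileD2 β C a r := by unfold profileD2; positivity
    rw [abs_of_nonneg h0]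
    calc profileD2 β C a r ≤ a * (E * invPow (β + 1 + 1) r) +
          (β * (β + 1) * invPow (β + 1 + 1) r
            + C * ((β + 1) * (β + 1 + 1) * invPow (β + 1 + 1) r)) := by
          unfold profileD2
          gcongr
          exact hexp.trans (by gcongr)
      _ = (a * E + k₂) * invPow (β + 1 + 1) r := by rw [hk₂]; ring
      _ ≤ _ := by
          refine mul_le_mul_of_nonneg_right ?_ p2.le
          linarith [mul_nonneg ha hk₂0, mul_nonneg ha hk₃0]
  · have h0 : -profileD3 β C a r = a * Real.exp (-r) + (β * (β + 1) * (β + 1 + 1) * invPow c r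
        + C * ((β + 1) * (β + 1 + 1) * c * invPow (c + 1) r)) := by
      unfold profileD3; ring
    rw [← abs_neg, h0, abs_of_nonneg (by positivity)]
    calc _ ≤ a * (E * invPow c r) + (β * (β + 1) * (β + 1 + 1) * invPow c r
            + C * ((β + 1) * (β + 1 + 1) * c * invPow c r)) := by gcongr
      _ = (a * E + k₃) * invPow c r := by rw [hk₃]; ring
      _ ≤ _ := by
          refine mul_le_mul_of_nonneg_right ?_ p3.le
          linarith [mul_nonneg ha hk₂0, mul_nonneg ha hk₃0]

/-- The Gaussian term of the profile absorbs the failure of the algebraic part to be a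
supersolution of the similarity equation near the origin. -/
theorem exists_profile_constants {β ν η : ℝ} (hβ : 0 ≤ β) (hν : 0 ≤ ν) (hη : 0 < η) :
    ∃ B C : ℝ, 0 ≤ B ∧ 0 ≤ C ∧ ∀ a r : ℝ, 0 ≤ r →
      (ν + r) * profileD1 β C a r + r * profileD2 β C a r + β * profile β C a r
        + invPow (β + 1) r ≤ (B * η - (ν - β) * a) * Real.exp (-r) := by
  -- Makes the coefficient of `P (1 + r)²` below equal to `βν + 2`: one unit is the required margin,
  -- the other absorbs the negative linear term, of size at most `C'`, once `1 + r ≥ C'`.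
  set C := β * (β + 2) + 2 with hC
  have hC0 : 0 ≤ C := by positivity
  set C' := C * ((β + 1) * (β + 3)) with hC'
  have hC'0 : 0 ≤ C' := by positivity
  -- For `1 + r < C'` the linear term is at most `C'`, and `e^{C'} e^{-r} ≥ 1`.
  refine ⟨C' * Real.exp C' / η, C, by positivity, hC0, fun a r hr => ?_⟩
  rw [div_mul_cancel₀ _ hη.ne']
  set P := invPow (β + 1 + 1 + 1) r with hP
  have hP0 : 0 < P := invPow_pos _ hr
  have q2 : invPow (β + 1 + 1) r = P * (1 + r) := invPow_eq_mul _ hr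
  have q1 : invPow (β + 1) r = P * (1 + r) ^ 2 := by rw [invPow_eq_mul _ hr, q2]; ring
  have q0 : invPow β r = P * (1 + r) ^ 3 := by rw [invPow_eq_mul _ hr, q1]; ring
  have hPy : P * (1 + r) ≤ 1 := q2 ▸ invPow_le_one (by positivity) hr
  have habsorb : C' * (P * (1 + r)) ≤ C' * Real.exp C' * Real.exp (-r) + P * (1 + r) ^ 2 := by
    rcases le_or_gt C' (1 + r) with h | h
    · have h1 : C' * (P * (1 + r)) ≤ (1 + r) * (P * (1 + r)) := by gcongr
      have h2 : 0 ≤ C' * Real.exp C' * Real.exp (-r) := by positivity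
      linarith
    · have h1 : 1 ≤ Real.exp C' * Real.exp (-r) := by
        rw [← Real.exp_add]; exact Real.one_le_exp (by linarith)
      have h2 : C' * (P * (1 + r)) ≤ C' * 1 := by gcongr
      have h3 : C' * 1 ≤ C' * (Real.exp C' * Real.exp (-r)) := by gcongr
      have h4 : 0 ≤ P * (1 + r) ^ 2 := by positivity
      linarith
  have hid : (ν + r) * profileD1 β C a r + r * profileD2 β C a r + β * profile β C a r
      = -(ν - β) * a * Real.exp (-r)
        - P * ((β * (ν - 2 - β) + C) * (1 + r) ^ 2
          + (β * (β + 1) + C * ((β + 1) * (ν - 3 - β))) * (1 + r)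
          + C * ((β + 1) * (β + 2))) := by
    simp only [profile, profileD1, profileD2, q0, q1, q2, ← hP]
    ring
  have hlow : 2 * (P * (1 + r) ^ 2) - C' * (P * (1 + r))
      ≤ P * ((β * (ν - 2 - β) + C) * (1 + r) ^ 2
          + (β * (β + 1) + C * ((β + 1) * (ν - 3 - β))) * (1 + r)
          + C * ((β + 1) * (β + 2))) := by
    have h1 : P * ((β * (ν - 2 - β) + C) * (1 + r) ^ 2
          + (β * (β + 1) + C * ((β + 1) * (ν - 3 - β))) * (1 + r)
          + C * ((β + 1) * (β + 2))) - (2 * (P * (1 + r) ^ 2) - C' * (P * (1 + r)))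
        = P * (β * ν * (1 + r) ^ 2 + (β * (β + 1) + C * ((β + 1) * ν)) * (1 + r)
          + C * ((β + 1) * (β + 2))) := by
      rw [hC', hC]; ring
    have h2 : 0 ≤ P * (β * ν * (1 + r) ^ 2 + (β * (β + 1) + C * ((β + 1) * ν)) * (1 + r)
          + C * ((β + 1) * (β + 2))) := by positivity
    linarith
  rw [hid, q1]
  linarith

/-- Supersolutions of `w_t = J * w - w` of self-similar type, with a slowly varying amplitude `g`
of the Gaussian part. -/
theorem IsKernel.exists_supersolution (hJ : IsKernel J) (hN : 1 ≤ N) {β η : ℝ} (hβ : 0 ≤ β)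
    (hη : 0 < η) {g g' : ℝ → ℝ} (hg : ∀ t, 1 ≤ t → HasDerivAt g (g' t) t)
    (hg0 : ∀ t, 1 ≤ t → 0 ≤ g t) (hgη : ∀ t, 1 ≤ t → η ≤ t * g' t + ((N : ℝ) / 2 - β) * g t)
    (hglim : Tendsto (fun t => g t / √t) atTop (𝓝 0)) :
    ∃ B C κ T₀ : ℝ, 0 ≤ B ∧ 0 ≤ C ∧ 0 < κ ∧ 1 ≤ T₀ ∧ ∀ t, T₀ ≤ t → ∀ x,
      ∃ d ≥ kernelAvg J (fun y => t ^ (-β) * profile β C (B * g t) (‖y‖ ^ 2 / (κ * t))) x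
          - t ^ (-β) * profile β C (B * g t) (‖x‖ ^ 2 / (κ * t)),
        HasDerivAt (fun s => s ^ (-β) * profile β C (B * g s) (‖x‖ ^ 2 / (κ * s))) d t := by
  set ν := (N : ℝ) / 2 with hν
  have hN0 : (0 : ℝ) < N := by positivity
  obtain ⟨B, C, hB, hC, hBC⟩ := exists_profile_constants hβ (show 0 ≤ ν by positivity) hη
  obtain ⟨K, hK, hKb⟩ := exists_profile_deriv_bounds hβ hC
  obtain ⟨C₁, τ₀, hC₁, hτ₀, hcons⟩ := hJ.exists_kernelAvg_radial_le hN hβ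
  have hm := hJ.secondMoment_pos hN
  set m := secondMoment J
  -- Normalises the diffusion so that `m / κ = N / 2 = ν`.
  set κ := 2 * m / N with hκ
  have hκ0 : 0 < κ := by positivity
  -- The Taylor error is of order `(g + 1) t^{-3/2}` against a margin of order `t^{-1}`, so `g =
  -- o(√t)` suffices for large `t`.
  have herr : ∀ᶠ t in atTop, C₁ * (K * (B * g t + 1)) / (κ * √κ * √t) ≤ 1 := by
    have h1 : Tendsto (fun t => C₁ * K / (κ * √κ) * (B * (g t / √t) + (√t)⁻¹)) atTop (𝓝 0) := by
      have := ((hglim.const_mul B).add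
        (tendsto_inv_atTop_zero.comp Real.tendsto_sqrt_atTop)).const_mul (C₁ * K / (κ * √κ))
      simpa using this
    filter_upwards [h1.eventually_le_const one_pos, eventually_gt_atTop 0] with t ht ht0
    have : 0 < √t := Real.sqrt_pos.2 ht0
    have : 0 < √κ := Real.sqrt_pos.2 hκ0
    refine le_of_eq_of_le ?_ ht
    field_simp
  obtain ⟨T₁, hT₁⟩ := eventually_atTop.1 herr
  refine ⟨B, C, κ, max 1 (max T₁ (τ₀ / κ)), hB, hC, hκ0, le_max_left _ _, fun t ht x => ?_⟩
  have ht1 : 1 ≤ t := (le_max_left _ _).trans ht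
  have htT : T₁ ≤ t := ((le_max_left _ _).trans (le_max_right _ _)).trans ht
  have htτ : τ₀ ≤ κ * t := by
    have : τ₀ / κ ≤ t := ((le_max_right _ _).trans (le_max_right _ _)).trans ht
    rwa [div_le_iff₀' hκ0] at this
  have ht0 : 0 < t := by linarith
  set r := ‖x‖ ^ 2 / (κ * t) with hr
  have hr0 : 0 ≤ r := by positivity
  set a := B * g t with ha
  have ha0 : 0 ≤ a := mul_nonneg hB (hg0 t ht1)
  set Q := t ^ (-β) with hQ
  have hQ0 : 0 < Q := by positivity
  have hrd : HasDerivAt (fun s => ‖x‖ ^ 2 / (κ * s)) (-(r / t)) t := by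
    have := ((hasDerivAt_id t).const_mul κ).fun_inv (by simpa using ⟨hκ0.ne', ht0.ne'⟩)
    refine (this.const_mul (‖x‖ ^ 2)).congr_deriv ?_
    simp only [id_eq, hr]
    field_simp
  have hprof : HasDerivAt (fun s => profile β C (B * g s) (‖x‖ ^ 2 / (κ * s)))
      (B * g' t * Real.exp (-r) + profileD1 β C a r * (-(r / t))) t := by
    have e1 := ((hg t ht1).const_mul B).mul (hrd.neg.exp)
    have e2 := (hasDerivAt_invPow β hr0).comp t hrd
    have e3 := ((hasDerivAt_invPow (β + 1) hr0).comp t hrd).const_mul C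
    refine (e1.add (e2.add e3)).congr_deriv ?_
    simp only [profileD1, ← hr, ← ha, Pi.neg_apply]
    ring
  have hpow : HasDerivAt (fun s : ℝ => s ^ (-β)) (-β * (Q / t)) t := by
    have := Real.hasDerivAt_rpow_const (x := t) (p := -β) (Or.inl ht0.ne')
    rwa [Real.rpow_sub_one ht0.ne'] at this
  refine ⟨_, ?_, hpow.mul hprof⟩
  rw [kernelAvg_const_mul]
  have havg := hcons (profile β C a) (profileD1 β C a) (profileD2 β C a) (profileD3 β C a)
    (K * (a + 1)) (by positivity) (fun s hs => hasDerivAt_profile β C a hs)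
    (fun s hs => hasDerivAt_profileD1 β C a hs) (fun s hs => hasDerivAt_profileD2 β C a hs)
    (fun s hs => (hKb a s ha0 hs).1) (fun s hs => (hKb a s ha0 hs).2) (κ * t) htτ x
  rw [← hr] at havg
  have hq := invPow_pos (β + 1) hr0
  have hsq : √(κ * t) ^ 3 = t * (κ * √κ * √t) := by
    have h1 : √(κ * t) = √κ * √t := Real.sqrt_mul hκ0.le t
    have h2 : √κ ^ 2 = κ := Real.sq_sqrt hκ0.le
    have h3 : √t ^ 2 = t := Real.sq_sqrt ht0.le
    calc √(κ * t) ^ 3 = √κ ^ 2 * √κ * (√t ^ 2 * √t) := by rw [h1]; ring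
      _ = _ := by rw [h2, h3]; ring
  have herr' : C₁ * (K * (a + 1)) / √(κ * t) ^ 3 * invPow (β + 1) r
      ≤ 1 / t * invPow (β + 1) r := by
    refine mul_le_mul_of_nonneg_right ?_ hq.le
    have : C₁ * (K * (a + 1)) / √(κ * t) ^ 3
        = 1 / t * (C₁ * (K * (a + 1)) / (κ * √κ * √t)) := by
      rw [hsq, div_mul_div_comm, one_mul]
    rw [this]
    exact mul_le_of_le_one_right (by positivity) (hT₁ t htT)
  have hlead : m / (κ * t) * (profileD1 β C a r + 2 / N * r * profileD2 β C a r)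
      = 1 / t * (ν * profileD1 β C a r + r * profileD2 β C a r) := by
    rw [hκ, hν]
    field_simp
  have hη' : B * η ≤ B * (t * g' t) + (ν - β) * a := by
    have := mul_le_mul_of_nonneg_left (hgη t ht1) hB
    rw [ha]
    linarith
  -- The supersolution inequality after division by `t^{-β-1}`, with `invPow (β + 1) r` standing for
  -- the Taylor error.
  have hfinal : ν * profileD1 β C a r + r * profileD2 β C a r + invPow (β + 1) r
      ≤ -β * profile β C a r + t * (B * g' t * Real.exp (-r)) - r * profileD1 β C a r := by
    have h1 := hBC a r hr0
    have h2 := mul_le_mul_of_nonneg_right hη' (Real.exp_nonneg (-r))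
    linarith
  have hdiv := mul_le_mul_of_nonneg_left hfinal (show 0 ≤ Q * (1 / t) by positivity)
  have hd : Q * (1 / t) * (-β * profile β C a r + t * (B * g' t * Real.exp (-r))
      - r * profileD1 β C a r)
      = -β * (Q / t) * profile β C a r
        + Q * (B * g' t * Real.exp (-r) + profileD1 β C a r * (-(r / t))) := by
    field_simp
    ring
  rw [hd] at hdiv
  have hQavg := mul_le_mul_of_nonneg_left (havg.trans (add_le_add_right herr' _)) hQ0.le
  rw [hlead] at hQavg
  linarith

/-! ### Decay rates for large time. -/

/-- Orders the initial datum below the supersolution: `(1 + r)^{-α/2}` has the same spatial decay as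
the weight. -/
theorem decay_le_profile {α κ t C a : ℝ} (hα : 0 ≤ α) (hκt : 0 < κ * t) (hC : 0 ≤ C) (ha : 0 ≤ a)
    (x : EuclideanSpace ℝ (Fin N)) :
    decay N α x ≤ (1 + (κ * t)⁻¹) ^ (α / 2) * profile (α / 2) C a (‖x‖ ^ 2 / (κ * t)) := by
  set r := ‖x‖ ^ 2 / (κ * t) with hr
  have hr0 : 0 ≤ r := by positivity
  have h1 : invPow (α / 2) r ≤ profile (α / 2) C a r := by
    have : 0 ≤ a * Real.exp (-r) := by positivity
    have : 0 ≤ C * invPow (α / 2 + 1) r := mul_nonneg hC (invPow_pos _ hr0).le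
    unfold profile
    linarith
  have h2 : decay N α x ≤ (1 + (κ * t)⁻¹) ^ (α / 2) * invPow (α / 2) r := by
    have h3 : 1 + r ≤ (1 + (κ * t)⁻¹) * (1 + ‖x‖) ^ 2 := by
      have hi : 0 < (κ * t)⁻¹ := inv_pos.2 hκt
      rw [hr, div_eq_mul_inv]
      nlinarith [norm_nonneg x, mul_nonneg hi.le (norm_nonneg x), sq_nonneg ‖x‖]
    have h4 : (1 + r) ^ (α / 2) ≤ (1 + (κ * t)⁻¹) ^ (α / 2) * (1 + ‖x‖) ^ α := by
      have h5 : ((1 + ‖x‖) ^ 2) ^ (α / 2) = (1 + ‖x‖) ^ α := by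
        rw [← Real.rpow_natCast, ← Real.rpow_mul (by positivity)]
        congr 1
        push_cast
        ring
      rw [← h5, ← Real.mul_rpow (by positivity) (by positivity)]
      exact Real.rpow_le_rpow (by positivity) h3 (by positivity)
    have hx : 0 < (1 + ‖x‖) ^ α := by positivity
    have hy : 0 < (1 + r) ^ (α / 2) := by positivity
    rw [decay, invPow, Real.rpow_neg (by positivity), Real.rpow_neg (by positivity),
      ← div_eq_mul_inv, le_div_iff₀ hy, inv_mul_le_iff₀ hx]
    linarith
  exact h2.trans (mul_le_mul_of_nonneg_left h1 (by positivity))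

section Solution

variable {p : ℝ} {u₀ : EuclideanSpace ℝ (Fin N) → ℝ} {u : ℝ → EuclideanSpace ℝ (Fin N) → ℝ}

/-- Reduces both decay rates to the choice of an amplitude `g`. The supersolution, valid only from
`T₀` on, is started at time `T₀`. -/
theorem IsSolution.exists_le_amplitude (hJ : IsKernel J) (hN : 1 ≤ N) (hu : IsSolution J p u₀ u)
    {α A : ℝ} (hα : 0 ≤ α) (hA : 0 ≤ A)
    (hlim : Tendsto (fun x => ‖x‖ ^ α * u₀ x) (essInfty N) (𝓝 A)) {η : ℝ}
    (hη : 0 < η) {g g' : ℝ → ℝ} (hg : ∀ t, 1 ≤ t → HasDerivAt g (g' t) t)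
    (hg0 : ∀ t, 1 ≤ t → 0 ≤ g t)
    (hgη : ∀ t, 1 ≤ t → η ≤ t * g' t + ((N : ℝ) / 2 - α / 2) * g t)
    (hglim : Tendsto (fun t => g t / √t) atTop (𝓝 0)) :
    ∃ D T₀ : ℝ, 0 ≤ D ∧ 1 ≤ T₀ ∧ ∀ᵐ x, ∀ t, 0 ≤ t →
      u t x ≤ D * ((T₀ + t) ^ (-(α / 2)) * (g (T₀ + t) + 1)) := by
  have hβ : 0 ≤ α / 2 := by positivity
  obtain ⟨B, C, κ, T₀, hB, hC, hκ, hT₀, hsuper⟩ :=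
    hJ.exists_supersolution hN hβ hη hg hg0 hgη hglim
  obtain ⟨C₀, hC₀, h0⟩ := hu.exists_initial_le hα hA hlim
  -- The last factor cancels `T₀ ^ (-(α / 2))` in the supersolution at its starting time.
  set L := C₀ * (1 + (κ * T₀)⁻¹) ^ (α / 2) * T₀ ^ (α / 2) with hL
  have hL0 : 0 ≤ L := by positivity
  set w : ℝ → EuclideanSpace ℝ (Fin N) → ℝ := fun t x =>
    t ^ (-(α / 2)) * profile (α / 2) C (B * g t) (‖x‖ ^ 2 / (κ * t)) with hw
  have hw0 : ∀ t, T₀ ≤ t → ∀ x, 0 ≤ w t x := fun t ht x => by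
    have : 0 < t := by linarith
    exact mul_nonneg (by positivity) (profile_nonneg _ hC (mul_nonneg hB (hg0 t (by linarith)))
      (by positivity))
  have hwle : ∀ t, T₀ ≤ t → ∀ x, w t x ≤ t ^ (-(α / 2)) * (B * g t + (1 + C)) := fun t ht x => by
    have : 0 < t := by linarith
    exact mul_le_mul_of_nonneg_left (profile_le hβ hC (mul_nonneg hB (hg0 t (by linarith)))
      (by positivity)) (by positivity)
  have hcomp : ∀ᵐ x, ∀ t, 0 ≤ t → u t x ≤ L * w (T₀ + t) x := by
    apply ae_forall_nonneg_of_nat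
    intro n
    obtain ⟨M, hM⟩ := hu.ae_bounded n
    have hderiv : ∀ x, ∀ t, 0 ≤ t → ∃ d ≥ kernelAvg J (fun y => L * w (T₀ + t) y) x
        - L * w (T₀ + t) x, HasDerivAt (fun s => L * w (T₀ + s) x) d t := by
      intro x t ht
      obtain ⟨d, hd, hder⟩ := hsuper (T₀ + t) (by linarith) x
      refine ⟨L * d, ?_, (hder.comp_const_add T₀ t).const_mul L⟩
      rw [kernelAvg_const_mul, ← mul_sub]
      exact mul_le_mul_of_nonneg_left hd hL0
    have hgc : ContinuousOn (fun t => t ^ (-(α / 2)) * (B * g t + (1 + C)))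
        (Icc T₀ (T₀ + n)) := by
      intro t ht
      have ht1 : 1 ≤ t := hT₀.trans ht.1
      exact (((Real.continuousAt_rpow_const t _ (Or.inl (by linarith))).mul
        (((hg t ht1).continuousAt.const_mul B).add_const _))).continuousWithinAt
    obtain ⟨M', hM'⟩ := isCompact_Icc.exists_bound_of_continuousOn hgc
    apply hJ.le_supersolution (z := u) (W := fun t x => L * w (T₀ + t) x) (G := fun _ _ => 0)
      (M := M) (M' := L * M') (T := n) (fun t ht => hu.measurable t ht.1.le)
    · filter_upwards [hu.continuousOn] with x hx using hx.mono Icc_subset_Ici_self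
    · exact hM
    · filter_upwards [hu.hasDerivAt hJ] with x hx t ht hpos
      refine ⟨_, ?_, hx t ht.1⟩
      have h1 : 0 ≤ |u t x| ^ (p - 1) * u t x := by positivity
      linarith
    · intro t ht
      have : 0 < κ * (T₀ + t) := mul_pos hκ (by linarith [ht.1])
      exact (((continuous_profile_comp _ _ _ (by fun_prop) fun x => by positivity).const_mul
        _).const_mul L).aestronglyMeasurable
    · exact fun t ht x => mul_nonneg hL0 (hw0 _ (by linarith [ht.1]) x)
    · intro t ht x
      refine mul_le_mul_of_nonneg_left ((hwle _ (by linarith [ht.1]) x).trans ?_) hL0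
      exact (le_abs_self _).trans (hM' _ ⟨by linarith [ht.1], by linarith [ht.2]⟩)
    · intro x t ht
      obtain ⟨d, -, hd⟩ := hderiv x t ht.1
      exact hd.continuousAt.continuousWithinAt
    · intro x t ht
      obtain ⟨d, hd, hd'⟩ := hderiv x t ht.1.le
      exact ⟨d, by simpa using hd, hd'⟩
    · filter_upwards [h0] with x hx
      have hT0 : 0 < T₀ := by linarith
      refine hx.trans ?_
      have h1 := mul_le_mul_of_nonneg_left (decay_le_profile (C := C) hα (mul_pos hκ hT0) hC
        (mul_nonneg hB (hg0 T₀ hT₀)) x) hC₀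
      refine h1.trans (le_of_eq ?_)
      have h2 : T₀ ^ (α / 2) * T₀ ^ (-(α / 2)) = 1 := by
        rw [← Real.rpow_add hT0, add_neg_cancel, Real.rpow_zero]
      simp only [add_zero, hL, hw]
      linear_combination (-(C₀ * (1 + (κ * T₀)⁻¹) ^ (α / 2)
        * profile (α / 2) C (B * g T₀) (‖x‖ ^ 2 / (κ * T₀)))) * h2
  refine ⟨L * (B + (1 + C)), T₀, by positivity, hT₀, ?_⟩
  filter_upwards [hcomp] with x hx t ht
  have hT : T₀ ≤ T₀ + t := by linarith
  have hpos : 0 < T₀ + t := by linarith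
  have hgt := hg0 (T₀ + t) (by linarith)
  refine (hx t ht).trans ?_
  calc L * w (T₀ + t) x
      ≤ L * ((T₀ + t) ^ (-(α / 2)) * (B * g (T₀ + t) + (1 + C))) :=
        mul_le_mul_of_nonneg_left (hwle _ hT x) hL0
    _ ≤ L * ((T₀ + t) ^ (-(α / 2)) * ((B + (1 + C)) * (g (T₀ + t) + 1))) := by
        have : 0 ≤ (1 + C) * g (T₀ + t) := by positivity
        gcongr
        linarith
    _ = _ := by ring

theorem IsSolution.exists_le_rpow (hJ : IsKernel J) (hN : 1 ≤ N) (hu : IsSolution J p u₀ u)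
    {α A : ℝ} (hα : 0 ≤ α) (hA : 0 ≤ A)
    (hlim : Tendsto (fun x => ‖x‖ ^ α * u₀ x) (essInfty N) (𝓝 A)) (hαN : α < N) :
    ∃ C : ℝ, ∀ᵐ x, ∀ t, 0 < t → u t x ≤ C * t ^ (-α / 2) := by
  obtain ⟨D, T₀, hD, hT₀, h⟩ := hu.exists_le_amplitude hJ hN hα hA hlim
    -- Below the critical exponent the Gaussian with constant amplitude already gains `ν - β > 0`.
    (η := (N : ℝ) / 2 - α / 2) (by linarith) (g := fun _ => 1) (g' := fun _ => 0)
    (fun t _ => hasDerivAt_const t 1) (fun _ _ => zero_le_one) (fun t _ => by linarith)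
    (by simpa [Function.comp_def] using
      tendsto_inv_atTop_zero.comp Real.tendsto_sqrt_atTop)
  refine ⟨D * 2, ?_⟩
  filter_upwards [h] with x hx t ht
  have h1 : (T₀ + t) ^ (-(α / 2)) ≤ t ^ (-(α / 2)) :=
    Real.rpow_le_rpow_of_nonpos ht (by linarith) (by linarith)
  rw [neg_div]
  calc u t x ≤ D * ((T₀ + t) ^ (-(α / 2)) * (1 + 1)) := hx t ht.le
    _ ≤ D * (t ^ (-(α / 2)) * (1 + 1)) := by gcongr
    _ = _ := by ring

theorem IsSolution.exists_le_rpow_mul_log (hJ : IsKernel J) (hN : 1 ≤ N)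
    (hu : IsSolution J p u₀ u) {A : ℝ} (hA : 0 ≤ A)
    (hlim : Tendsto (fun x => ‖x‖ ^ (N : ℝ) * u₀ x) (essInfty N) (𝓝 A)) {t₀ : ℝ} (ht₀ : 1 < t₀) :
    ∃ C : ℝ, ∀ᵐ x, ∀ t, t₀ ≤ t → u t x ≤ C * t ^ (-(N : ℝ) / 2) * Real.log t := by
  have hloglim : Tendsto (fun t => Real.log t / √t) atTop (𝓝 0) := by
    have := (isLittleO_log_rpow_atTop (r := 1 / 2) (by norm_num)).tendsto_div_nhds_zero
    simpa only [Real.sqrt_eq_rpow] using this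
  obtain ⟨D, T₀, hD, hT₀, h⟩ := hu.exists_le_amplitude hJ hN (Nat.cast_nonneg N) hA hlim
    -- At `α = N` only `t g'` is left, and `g = log` makes it equal to `1`.
    one_pos (g := Real.log) (g' := fun t => t⁻¹)
    (fun t ht => Real.hasDerivAt_log (by linarith)) (fun t ht => Real.log_nonneg ht)
    (fun t ht => by
      rw [sub_self, zero_mul, add_zero, mul_inv_cancel₀ (by linarith)]) hloglim
  have hl₀ : 0 < Real.log t₀ := Real.log_pos ht₀
  have hlT : 0 ≤ Real.log (T₀ + 1) := Real.log_nonneg (by linarith)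
  -- Since `T₀ + t ≤ (T₀ + 1) t`, the shift costs an additive constant, absorbed through `log t ≥
  -- log t₀ > 0`.
  refine ⟨D * ((Real.log (T₀ + 1) + 1) / Real.log t₀ + 1), ?_⟩
  filter_upwards [h] with x hx t ht
  have ht1 : 1 < t := ht₀.trans_le ht
  have ht0 : 0 < t := by linarith
  have h1 : (T₀ + t) ^ (-((N : ℝ) / 2)) ≤ t ^ (-((N : ℝ) / 2)) :=
    Real.rpow_le_rpow_of_nonpos ht0 (by linarith) (by simp; positivity)
  have hlog : Real.log t₀ ≤ Real.log t := Real.log_le_log (by linarith) ht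
  have h2 : Real.log (T₀ + t) ≤ Real.log (T₀ + 1) + Real.log t := by
    rw [← Real.log_mul (by linarith) ht0.ne']
    exact Real.log_le_log (by linarith) (by nlinarith)
  have h3 : Real.log (T₀ + 1) + 1 ≤ (Real.log (T₀ + 1) + 1) / Real.log t₀ * Real.log t := by
    rw [div_mul_eq_mul_div, le_div_iff₀ hl₀]
    exact mul_le_mul_of_nonneg_left hlog (by linarith)
  have h4 : 0 ≤ Real.log (T₀ + t) := Real.log_nonneg (by linarith)
  rw [neg_div]
  calc u t x ≤ D * ((T₀ + t) ^ (-((N : ℝ) / 2)) * (Real.log (T₀ + t) + 1)) := hx t ht0.le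
    _ ≤ D * (t ^ (-((N : ℝ) / 2)) *
          (((Real.log (T₀ + 1) + 1) / Real.log t₀ + 1) * Real.log t)) := by
        gcongr
        linarith
    _ = _ := by ring

end Solution

end NonlocalDiffusion

theorem theorem3p1 {N : ℕ} (hN : 1 ≤ N)
    (J : EuclideanSpace ℝ (Fin N) → ℝ) (hJ : NonlocalDiffusion.IsKernel J)
    (α A p : ℝ) (hα : 0 < α) (hA : 0 < A) (hp : 1 < p)
    (u₀ : EuclideanSpace ℝ (Fin N) → ℝ)
    (hu₀ : MemLp u₀ ∞ volume) (hu₀_nonneg : ∀ᵐ x, 0 ≤ u₀ x)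
    (hu₀_lim : Tendsto (fun x => ‖x‖ ^ α * u₀ x) (NonlocalDiffusion.essInfty N) (𝓝 A))
    (u : ℝ → EuclideanSpace ℝ (Fin N) → ℝ) (hu : NonlocalDiffusion.IsSolution J p u₀ u) :
    (∀ T : ℝ, ∃ C : ℝ, ∀ᵐ x, ∀ t ∈ Icc 0 T, u t x ≤ C * (1 + ‖x‖) ^ (-α)) ∧
    (α < N → ∃ C : ℝ, ∀ᵐ x, ∀ t, 0 < t → u t x ≤ C * t ^ (-α / 2)) ∧
    (α = N → ∀ t₀ : ℝ, 1 < t₀ → ∃ C : ℝ, ∀ᵐ x, ∀ t, t₀ ≤ t →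
      u t x ≤ C * t ^ (-(N : ℝ) / 2) * Real.log t) ∧
    (∀ T : ℝ, TendstoUniformlyOn (fun x t => ‖x‖ ^ α * u t x) (fun _ => A)
      (NonlocalDiffusion.essInfty N) (Icc 0 T)) := by
  refine ⟨fun T => ?_, hu.exists_le_rpow hJ hN hα.le hA.le hu₀_lim, ?_,
    hu.tendstoUniformlyOn hJ hu₀_nonneg hp hα hA.le hu₀_lim⟩
  · obtain ⟨C, -, hC⟩ := hu.exists_le_decay hJ hα.le hA.le hu₀_lim T
    exact ⟨C, hC⟩
  · rintro rfl t₀ ht₀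
    exact hu.exists_le_rpow_mul_log hJ hN hA.le hu₀_lim ht₀
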